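/- Let $n\ge 2$, $\kappa>1$, let $\Omega\subset S^{n-1}$ be a domain (nonempty, open, connected) whose boundary in $S^{n-1}$ has zero surface measure, and let $D\subset\mathbb R^n$ be a compact set (for instance a compact hypersurface) with $0\notin D$. Assume: (H3) for some $0<\tau<1-\frac1\kappa$, $\ x\cdot\frac{P}{|P|}\ge \frac1\kappa+\tau$ for all $x\in\overline\Omega$, $P\in D$; (H4) $0<r_0<\frac{\kappa^2\tau^2}{4(\kappa-1)^2}\inf_{P\in D}|P|$ and, with $Q_{r_0}=\{tx:x\in\overline\Omega,\ 0<t\le r_0\}$, for each $X\in Q_{r_0}$ and each $m\in S^{n-1}$ the ray $\{X+tm:t\ge0\}$ meets $D$ in at most one point. For $P\in D$ and $|P|<b<\kappa|P|$ put $$h(x,P,b)=\frac{(\kappa^2x\cdot P-b)-\sqrt{(\kappa^2x\cdot P-b)^2-(\kappa^2-1)(\kappa^2|P|^2-b^2)}}{\kappa^2-1},\qquad I(P,b)=\frac{b+\sqrt{(\kappa^2-1)(\kappa^2|P|^2-b^2)}}{\kappa^2|P|},$$ and let $\mathcal O(P,b)=\{h(x,P,b)x: x\in S^{n-1},\ x\cdot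 P\ge I(P,b)|P|\}$ be the refracting piece of the Cartesian oval $|X|+\kappa|X-P|=b$. Let $\rho$ be a positive continuous function on $\overline\Omega$ and $\mathcal S=\{\rho(x)x:x\in\overline\Omega\}\subset Q_{r_0}$. The oval $\mathcal O(P,b)$ supports $\mathcal S$ at $\rho(y)y$, $y\in\overline\Omega$, if $\overline\Omega\subset\{x: x\cdot P\ge I(P,b)|P|\}$ and $\rho(x)\ge h(x,P,b)$ for all $x\in\overline\Omega$, with equality at $x=y$. $\mathcal S$ is a near field refractor if at each of its points it is supported by some $\mathcal O(P,b)$ with $P\in D$ and $|P|<b<\kappa|P|$. Its refractor map is $\mathcal R_{\mathcal S}(x)=\{P\in D:\text{ some }\mathcal O(P,b)\text{ with }|P|<b<\kappa|P|\text{ supports }\mathcal S\text{ at }\rho(x)x\}$, and $\mathcal R_{\mathcal S}^{-1}(F)=\{x\in\overline\Omega:\mathcal R_{\mathcal S}(x)\cap F\neq\emptyset\}$. Given $f$ and $\mu$, the near field refractor $\mathcal S$ is a weak solution of the near field refractor problem if for every Borel set $F\subset D$ the set $\mathcal R_{\mathcal S}^{-1}(F)$ is measurable (for the completed surface measure $dx$)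 and $\int_{\mathcal R_{\mathcal S}^{-1}(F)}f\,dx=\mu(F)$. Theorem. Let $f\in L^1(\Omega)$ with $f>0$ a.e. in $\Omega$, and let $\mu$ be a Radon measure on $D$ with $\int_\Omega f\,dx=\mu(D)$. Then for every $X_0\in Q_{r_0}$ with $$0<|X_0|<\frac{r_0^4}{8\left(\sup_{P\in D}|P|\right)^3}$$ there exists a weak solution $\mathcal S$ of the near field refractor problem with $X_0\in\mathcal S$. -/

import Mathlib

open MeasureTheory Set

namespace NearField

noncomputable section

/-- Euclidean space `ℝⁿ`. -/
abbrev Space (n : ℕ) : Type := EuclideanSpace ℝ (Fin n)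

/-- The unit sphere `S^{n-1}` of `ℝⁿ`. -/
abbrev Sph (n : ℕ) : Type := Metric.sphere (0 : Space n) 1

/-- The surface measure on `S^{n-1}`. -/
abbrev surf (n : ℕ) : Measure (Sph n) := (volume : Measure (Space n)).toSphere

/-- The cone `Q_{r₀} = {t x : x ∈ closure Ω, 0 < t ≤ r₀}`. -/
def cone {n : ℕ} (Ω : Set (Sph n)) (r₀ : ℝ) : Set (Space n) :=
  {X | ∃ x ∈ closure Ω, ∃ t : ℝ, 0 < t ∧ t ≤ r₀ ∧ X = t • (x : Space n)}

/-- The ray `{X + t m : t ≥ 0}`. -/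
def ray {n : ℕ} (X m : Space n) : Set (Space n) :=
  {Y | ∃ t : ℝ, 0 ≤ t ∧ Y = X + t • m}

/-- The angular condition: `inf x · P / |P| ≥ 1/κ + τ` over `x ∈ closure Ω`, `P ∈ D`,
with `0 < τ < 1 - 1/κ`. -/
structure AngleCondition {n : ℕ} (κ τ : ℝ) (Ω : Set (Sph n)) (D : Set (Space n)) : Prop where
  tau_pos : 0 < τ
  tau_lt : τ < 1 - 1 / κ
  angle : ∀ x ∈ closure Ω, ∀ P ∈ D, 1 / κ + τ ≤ inner ℝ (x : Space n) P / ‖P‖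

/-- The visibility condition: `0 < r₀ < κ² τ² / (4 (κ - 1)²) · inf_D |P|`, and every ray emanating
from a point of `Q_{r₀}` meets `D` in at most one point. -/
structure VisibilityCondition {n : ℕ} (κ τ r₀ : ℝ) (Ω : Set (Sph n)) (D : Set (Space n)) :
    Prop where
  r_pos : 0 < r₀
  r_lt : r₀ < κ ^ 2 * τ ^ 2 / (4 * (κ - 1) ^ 2) * sInf ((fun P : Space n => ‖P‖) '' D)
  visible : ∀ X ∈ cone Ω r₀, ∀ m : Space n, ‖m‖ = 1 → (D ∩ ray X m).Subsingleton

/-- The polar radius `h(x, P, b)` (case `κ > 1`) of the oval `|X| + κ |X - P| = b`,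
for the smaller of the two roots. -/
def ovalRadius {n : ℕ} (κ : ℝ) (P : Space n) (b : ℝ) (x : Sph n) : ℝ :=
  ((κ ^ 2 * inner ℝ (x : Space n) P - b)
    - Real.sqrt ((κ ^ 2 * inner ℝ (x : Space n) P - b) ^ 2
        - (κ ^ 2 - 1) * (κ ^ 2 * ‖P‖ ^ 2 - b ^ 2))) / (κ ^ 2 - 1)

/-- The aperture `I(P, b)` of the refracting piece of the oval. -/
def ovalAperture {n : ℕ} (κ : ℝ) (P : Space n) (b : ℝ) : ℝ :=
  (b + Real.sqrt ((κ ^ 2 - 1) * (κ ^ 2 * ‖P‖ ^ 2 - b ^ 2))) / (κ ^ 2 * ‖P‖)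

/-- The set `Γ(P, b)` of directions in the refracting oval piece. -/
def ovalDirections {n : ℕ} (κ : ℝ) (P : Space n) (b : ℝ) : Set (Sph n) :=
  {x | ovalAperture κ P b * ‖P‖ ≤ inner ℝ (x : Space n) P}

/-- The refracting oval piece `O(P, b)`, which is defined for `|P| < b < κ |P|`, supports from
below the surface `{ρ(x) x : x ∈ closure Ω}` at the point `ρ(y) y`. -/
structure IsSupportingOval {n : ℕ} (κ : ℝ) (Ω : Set (Sph n)) (ρ : Sph n → ℝ)
    (P : Space n) (b : ℝ) (y : Sph n) : Prop where
  lt_b : ‖P‖ < b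
  b_lt : b < κ * ‖P‖
  directions : closure Ω ⊆ ovalDirections κ P b
  le : ∀ x ∈ closure Ω, ovalRadius κ P b x ≤ ρ x
  eq : ρ y = ovalRadius κ P b y

/-- The radial graph `S = {ρ(x) x : x ∈ closure Ω}`. Only the values of `ρ` on `closure Ω`
are relevant. -/
def radialGraph {n : ℕ} (Ω : Set (Sph n)) (ρ : Sph n → ℝ) : Set (Space n) :=
  {X | ∃ x ∈ closure Ω, X = ρ x • (x : Space n)}

/-- `ρ` is the (positive, continuous) radial function of a near field refractor contained in
`Q_{r₀}`, for `κ > 1`. -/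
structure IsRefractor {n : ℕ} (κ r₀ : ℝ) (Ω : Set (Sph n)) (D : Set (Space n))
    (ρ : Sph n → ℝ) : Prop where
  continuousOn : ContinuousOn ρ (closure Ω)
  pos : ∀ x ∈ closure Ω, 0 < ρ x
  subset_cone : radialGraph Ω ρ ⊆ cone Ω r₀
  supported : ∀ y ∈ closure Ω, ∃ P ∈ D, ∃ b : ℝ, IsSupportingOval κ Ω ρ P b y

/-- The (set-valued) refractor map `R_S` with values in `D`. -/
def refractorMap {n : ℕ} (κ : ℝ) (Ω : Set (Sph n)) (D : Set (Space n)) (ρ : Sph n → ℝ)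
    (x : Sph n) : Set D :=
  {P | ∃ b : ℝ, IsSupportingOval κ Ω ρ (P : Space n) b x}

/-- `R_S⁻¹(F) = {x ∈ closure Ω : R_S(x) ∩ F ≠ ∅}`. -/
def refractorPreimage {n : ℕ} (κ : ℝ) (Ω : Set (Sph n)) (D : Set (Space n)) (ρ : Sph n → ℝ)
    (F : Set D) : Set (Sph n) :=
  {x | x ∈ closure Ω ∧ (refractorMap κ Ω D ρ x ∩ F).Nonempty}

/-- `ρ` is the radial function of a weak solution of the near field refractor problem with emitted
intensity `f` and prescribed refracted intensity `μ`: a near field refractor such that, for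
every Borel set `F ⊆ D`, the set `R_S⁻¹(F)` is measurable (with respect to the completed surface
measure) and `∫_{R_S⁻¹(F)} f dx = μ(F)`. -/
structure IsWeakSolution {n : ℕ} (κ r₀ : ℝ) (Ω : Set (Sph n)) (D : Set (Space n))
    (f : Sph n → ℝ) (μ : Measure D) (ρ : Sph n → ℝ) : Prop where
  refractor : IsRefractor κ r₀ Ω D ρ
  measurable_preimage : ∀ F : Set D, MeasurableSet F →
    NullMeasurableSet (refractorPreimage κ Ω D ρ F) (surf n)
  energy : ∀ F : Set D, MeasurableSet F →
    ∫ x in refractorPreimage κ Ω D ρ F, f x ∂(surf n) = μ.real F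

end

end NearField

/-!
The refractor is found as an upper envelope of ovals. Put `x₀ = X₀ / |X₀|` and `r = |X₀|`. For
`P ∈ D` and `s ∈ [0, r]` exactly one oval with focus `P` passes through `s x₀`; its polar radius
`axisRadius` is strictly increasing in `s`, vanishes for `s = 0`, and stays below `r₀` on
`closure Ω`. This rests on `IsAdmissible.norm_lt`: inside the cone `Q_{r₀}` the direction `m`
towards a target point satisfies `κ x · m > 1`, so that the optical length `|X| + κ |X - P|`
decreases along rays from the origin. A nonempty compact set `K` of pairs `(P, s)` has an upper
envelope, which is a refractor as soon as some `s` is positive, and which passes through `X₀` as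
soon as the value `s = r` occurs.

The refractor map is single-valued almost everywhere (`ae_refractorMap_subsingleton`). Envelopes are
Lipschitz, hence by Rademacher's theorem differentiable along almost every ray; at a point of
differentiability all supporting ovals have the tangent plane of the surface, which determines the
refracted direction `m` (`IsSupportingOval.focus_eq`), and by the visibility condition the ray in
direction `m` contains only one target point.

For a target measure with finite support the parameters `s` are found by an extremal argument
(`IsMonotoneFamily.exists_measureReal_cell_eq`): raising one parameter enlarges the corresponding
cell and shrinks all the others, so the vectors `s` all of whose cells, except that of one fixed
index, are at most as large as prescribed are stable under suprema. Extremal such vectors with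
`max s = r` have exactly the prescribed cells.

In general the target measure is approximated by measures with finite support
(`AxisSetup.exists_envelope`). The compact subsets of `D × [0, r]` form a compact space for the
Hausdorff distance, and along a convergent sequence of families the refractor maps converge almost
everywhere, because limits of maximal elements are maximal and the limit map is single-valued. By
dominated convergence the limit map transports `f dx` to `μ`, which is the weak formulation
(`isWeakSolution_of_map_eq`).
-/

namespace NearField

noncomputable section

/-! ### Ovals in a fixed direction -/

/-- The optical length `|X| + κ |X - P|` of the path from the origin to `P` that is refracted
at `X`; the oval with parameter `b` is its level set at height `b`. -/
def opticalLength {n : ℕ} (κ : ℝ) (P X : Space n) : ℝ := ‖X‖ + κ * ‖X - P‖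

/-- The direction `x` and the target point `P` are in the relative position which the angular
condition and the smallness of `r₀` provide. -/
structure IsAdmissible {n : ℕ} (κ τ r₀ : ℝ) (x : Sph n) (P : Space n) : Prop where
  one_lt : 1 < κ
  tau_pos : 0 < τ
  norm_pos : 0 < ‖P‖
  angle : (1 + κ * τ) * ‖P‖ ≤ κ * inner ℝ (x : Space n) P
  small : 2 * (κ ^ 2 - 1) * r₀ ≤ κ ^ 2 * τ * ‖P‖

lemma inner_le_norm_of_sphere {n : ℕ} (x : Sph n) (P : Space n) :
    inner ℝ (x : Space n) P ≤ ‖P‖ := by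
  simpa using real_inner_le_norm (x : Space n) P

lemma norm_smul_sub_sq {n : ℕ} (x : Sph n) (P : Space n) (t : ℝ) :
    ‖t • (x : Space n) - P‖ ^ 2 = t ^ 2 - 2 * t * inner ℝ (x : Space n) P + ‖P‖ ^ 2 := by
  rw [norm_sub_sq_real, norm_smul, inner_smul_left]
  simp
  ring

lemma opticalLength_smul {n : ℕ} (κ : ℝ) (x : Sph n) (P : Space n) {t : ℝ} (ht : 0 ≤ t) :
    opticalLength κ P (t • (x : Space n)) = t + κ * ‖t • (x : Space n) - P‖ := by
  simp [opticalLength, norm_smul, abs_of_nonneg ht]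

section Admissible

variable {n : ℕ} {κ τ r₀ : ℝ} {x : Sph n} {P : Space n}

/-- At a point `t x` with `t ≤ r₀`, the refracted direction `m` towards `P` satisfies
`κ x · m > 1`. -/
lemma IsAdmissible.norm_lt (h : IsAdmissible κ τ r₀ x P) {t : ℝ} (ht : t ≤ r₀) :
    ‖t • (x : Space n) - P‖ < κ * (inner ℝ (x : Space n) P - t) := by
  obtain ⟨h1, hτ, hp, ha, hs⟩ := h
  have hN := norm_smul_sub_sq x P t
  have hqp := inner_le_norm_of_sphere x P
  set q := inner ℝ (x : Space n) P
  set p := ‖P‖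
  set N := ‖t • (x : Space n) - P‖
  have hκτ : 0 < κ * τ := by positivity
  have hk : 0 < κ ^ 2 - 1 := by nlinarith
  have ht' : 2 * (κ ^ 2 - 1) * t ≤ κ ^ 2 * τ * p :=
    (mul_le_mul_of_nonneg_left ht (by positivity)).trans hs
  have hq : 0 < q := by
    by_contra hq
    nlinarith [mul_pos hκτ hp]
  have htq : t < q := by
    by_contra htq
    push Not at htq
    have h2 : 2 * (κ ^ 2 - 1) * q ≤ 2 * (κ ^ 2 - 1) * t := by gcongr
    have h3 : κ * ((1 + κ * τ) * p) ≤ κ * (κ * q) := by gcongr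
    nlinarith [mul_le_mul_of_nonneg_left hqp (by positivity : (0 : ℝ) ≤ κ),
      mul_pos (sub_pos.2 h1) hq]
  -- after squaring, the inequality is `0 < κ² q² - p² - 2 (κ² - 1) q t + (κ² - 1) t²`
  refine lt_of_pow_lt_pow_left₀ 2 (mul_nonneg (by positivity) (by linarith)) ?_
  have h4 : κ * τ * p * (κ * q + p) ≤ (κ * q - p) * (κ * q + p) := by
    gcongr
    linarith
  have h5 : 2 * (κ ^ 2 - 1) * t * q ≤ κ ^ 2 * τ * p * q := by gcongr
  have h6 : 0 < κ * τ * p * p := by positivity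
  rw [hN]
  nlinarith [mul_nonneg hk.le (sq_nonneg t)]

lemma IsAdmissible.norm_pos_of_le (h : IsAdmissible κ τ r₀ x P) {t : ℝ} (ht : t ≤ r₀) :
    0 < ‖t • (x : Space n) - P‖ := by
  obtain ⟨h1, hτ, hp, ha, hs⟩ := id h
  refine norm_pos_iff.2 fun h0 => ?_
  have h2 := h.norm_lt ht
  rw [sub_eq_zero] at h0
  rw [h0] at h2
  have h3 : inner ℝ (x : Space n) P = t := by
    rw [← h0, inner_smul_right]
    simp
  simp [h3] at h2

/-- The optical length strictly decreases along the segment from the origin to `r₀ x`. -/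
lemma IsAdmissible.strictAntiOn (h : IsAdmissible κ τ r₀ x P) :
    StrictAntiOn (fun t : ℝ => opticalLength κ P (t • (x : Space n))) (Icc 0 r₀) := by
  intro t ht t' ht' htt
  have hv := h.norm_lt ht'.2
  have hpos := h.norm_pos_of_le ht'.2
  have h1 := h.one_lt
  simp only [opticalLength_smul κ x P ht.1, opticalLength_smul κ x P ht'.1]
  -- convexity of the distance to `P`: its graph lies above the tangent line at `t'`
  have hcs := real_inner_le_norm (t • (x : Space n) - P) (t' • (x : Space n) - P)
  have hin : inner ℝ (t • (x : Space n) - P) (t' • (x : Space n) - P)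
      = ‖t' • (x : Space n) - P‖ ^ 2 + (t' - t) * (inner ℝ (x : Space n) P - t') := by
    rw [norm_smul_sub_sq]
    simp only [inner_sub_left, inner_sub_right, inner_smul_left, inner_smul_right,
      real_inner_self_eq_norm_sq, real_inner_comm (x : Space n) P]
    simp
    ring
  rw [hin] at hcs
  set N := ‖t • (x : Space n) - P‖
  set N' := ‖t' • (x : Space n) - P‖
  set q := inner ℝ (x : Space n) P
  have h2 : (t' - t) * N' < (t' - t) * (κ * (q - t')) :=
    mul_lt_mul_of_pos_left hv (sub_pos.2 htt)
  have h3 : N' * (t' + κ * N') < N' * (t + κ * N) := by nlinarith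
  exact lt_of_mul_lt_mul_left h3 hpos.le

end Admissible

/-- The discriminant of the quadratic equation for the polar radius of an oval. -/
def ovalDiscrim {n : ℕ} (κ : ℝ) (P : Space n) (b : ℝ) (x : Sph n) : ℝ :=
  (κ ^ 2 * inner ℝ (x : Space n) P - b) ^ 2 - (κ ^ 2 - 1) * (κ ^ 2 * ‖P‖ ^ 2 - b ^ 2)

/-- The aperture condition says that the discriminant is nonnegative and that both roots have
nonnegative sum. -/
lemma mem_ovalDirections_iff {n : ℕ} {κ b : ℝ} {P : Space n} {x : Sph n} (hκ : κ ≠ 0)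
    (hP : ‖P‖ ≠ 0) : x ∈ ovalDirections κ P b ↔
      √((κ ^ 2 - 1) * (κ ^ 2 * ‖P‖ ^ 2 - b ^ 2)) ≤ κ ^ 2 * inner ℝ (x : Space n) P - b := by
  have hk : 0 < κ ^ 2 := by positivity
  have : ovalAperture κ P b * ‖P‖
      = (b + √((κ ^ 2 - 1) * (κ ^ 2 * ‖P‖ ^ 2 - b ^ 2))) / κ ^ 2 := by
    rw [ovalAperture]
    field_simp
  rw [ovalDirections, mem_ofPred_eq, this, div_le_iff₀ hk]
  constructor <;> intro h <;> linarith

section Root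

variable {n : ℕ} {κ b : ℝ} {P : Space n} {x : Sph n}

lemma ovalRadius_mul (hκ : 1 < κ) : (κ ^ 2 - 1) * ovalRadius κ P b x
    = κ ^ 2 * inner ℝ (x : Space n) P - b - √(ovalDiscrim κ P b x) := by
  have hk : κ ^ 2 - 1 ≠ 0 := by nlinarith
  rw [ovalRadius, ovalDiscrim]
  field_simp

lemma ovalDiscrim_nonneg (hκ : 1 < κ) (hP : 0 < ‖P‖) (hb : ‖P‖ < b) (hb' : b ≤ κ * ‖P‖)
    (hx : x ∈ ovalDirections κ P b) : 0 ≤ ovalDiscrim κ P b x := by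
  rw [mem_ovalDirections_iff (by positivity) hP.ne'] at hx
  have hC : 0 ≤ (κ ^ 2 - 1) * (κ ^ 2 * ‖P‖ ^ 2 - b ^ 2) :=
    mul_nonneg (by nlinarith) (by nlinarith)
  have := pow_le_pow_left₀ (Real.sqrt_nonneg _) hx 2
  rw [Real.sq_sqrt hC] at this
  rw [ovalDiscrim]
  linarith

/-- The point with polar radius `h(x, P, b)` lies on the oval. -/
lemma opticalLength_ovalRadius (hκ : 1 < κ) (hP : 0 < ‖P‖) (hb : ‖P‖ < b) (hb' : b ≤ κ * ‖P‖)
    (hx : x ∈ ovalDirections κ P b) :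
    0 ≤ ovalRadius κ P b x ∧
      ovalRadius κ P b x + κ * ‖ovalRadius κ P b x • (x : Space n) - P‖ = b := by
  have hk : 0 < κ ^ 2 - 1 := by nlinarith
  have hd := ovalDiscrim_nonneg hκ hP hb hb' hx
  have hm := ovalRadius_mul (κ := κ) (P := P) (b := b) (x := x) hκ
  have hN := norm_smul_sub_sq x P (ovalRadius κ P b x)
  have hN0 := norm_nonneg (ovalRadius κ P b x • (x : Space n) - P)
  have hqp := inner_le_norm_of_sphere x P
  rw [mem_ovalDirections_iff (by positivity) hP.ne'] at hx
  have hy := (Real.sqrt_nonneg _).trans hx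
  have hr := Real.sq_sqrt hd
  have hr0 := Real.sqrt_nonneg (ovalDiscrim κ P b x)
  set h := ovalRadius κ P b x
  set r := √(ovalDiscrim κ P b x)
  rw [ovalDiscrim] at hr
  set q := inner ℝ (x : Space n) P
  have hC : 0 ≤ (κ ^ 2 - 1) * (κ ^ 2 * ‖P‖ ^ 2 - b ^ 2) :=
    mul_nonneg (by nlinarith) (by nlinarith)
  constructor
  · have : r ≤ κ ^ 2 * q - b := by
      refine le_of_sq_le_sq ?_ hy
      linarith
    by_contra hh
    push Not at hh
    nlinarith
  · have h1 : (κ ^ 2 - 1) * h < (κ ^ 2 - 1) * b := by nlinarith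
    have h2 : h < b := lt_of_mul_lt_mul_left h1 hk.le
    have h3 : (κ ^ 2 - 1) * ((κ * ‖h • (x : Space n) - P‖) ^ 2) = (κ ^ 2 - 1) * ((b - h) ^ 2) := by
      rw [mul_pow, hN]
      have : r = κ ^ 2 * q - b - (κ ^ 2 - 1) * h := by linarith
      rw [this] at hr
      linear_combination hr
    have h4 := mul_left_cancel₀ hk.ne' h3
    have h5 : κ * ‖h • (x : Space n) - P‖ = b - h :=
      (pow_left_inj₀ (by positivity) (by linarith) two_ne_zero).1 h4
    linarith

end Root

/-! ### The ovals through the points of the axis `ℝ₊ x₀` -/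

/-- The standing geometric assumptions: every direction in `closure Ω` is admissible for every
target point, and `r`, the distance from the origin at which the ray of direction `x₀` is to meet
the refractor, is small compared with `r₀`. -/
structure AxisSetup {n : ℕ} (κ τ r₀ r : ℝ) (Ω : Set (Sph n)) (D : Set (Space n))
    (x₀ : Sph n) : Prop where
  one_lt : 1 < κ
  tau_pos : 0 < τ
  tau_le : κ * τ ≤ κ - 1
  r_pos : 0 < r
  r_le : 2 * (κ - 1) * r ≤ κ * τ * r₀
  mem : x₀ ∈ closure Ω
  isCompact : IsCompact D
  adm : ∀ x ∈ closure Ω, ∀ P ∈ D, IsAdmissible κ τ r₀ x P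

/-- The parameter `b` of the oval with focus `P` that passes through `s x₀`. -/
def axisParam {n : ℕ} (κ : ℝ) (x₀ : Sph n) (P : Space n) (s : ℝ) : ℝ :=
  opticalLength κ P (s • (x₀ : Space n))

/-- The polar radius of the oval with focus `P` that passes through `s x₀`. -/
def axisRadius {n : ℕ} (κ : ℝ) (x₀ : Sph n) (P : Space n) (s : ℝ) (x : Sph n) : ℝ :=
  ovalRadius κ P (axisParam κ x₀ P s) x

namespace AxisSetup

variable {n : ℕ} {κ τ r₀ r : ℝ} {Ω : Set (Sph n)} {D : Set (Space n)} {x₀ : Sph n}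
  {P : Space n} {s : ℝ} {x : Sph n}

lemma two_mul_le (S : AxisSetup κ τ r₀ r Ω D x₀) : 2 * r ≤ r₀ := by
  obtain ⟨h1, hτ, h2, h3, h4, -, -, -⟩ := S
  have hκτ : 0 < κ * τ := by positivity
  have hr₀ : 0 < r₀ := by
    have : 0 < κ * τ * r₀ := lt_of_lt_of_le (by have := sub_pos.2 h1; positivity) h4
    exact (pos_iff_pos_of_mul_pos this).1 hκτ
  have : (κ - 1) * (2 * r) ≤ (κ - 1) * r₀ := by nlinarith
  exact le_of_mul_le_mul_left this (by linarith)

lemma r₀_pos (S : AxisSetup κ τ r₀ r Ω D x₀) : 0 < r₀ := by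
  linarith [S.two_mul_le, S.r_pos]

lemma r₀_lt_norm (S : AxisSetup κ τ r₀ r Ω D x₀) (hP : P ∈ D) : r₀ < ‖P‖ := by
  obtain ⟨h1, hτ, h2, -, -, hx, -, hadm⟩ := id S
  obtain ⟨-, -, hp, -, hs⟩ := hadm _ hx P hP
  have hr := S.r₀_pos
  have h3 : κ ^ 2 * τ * ‖P‖ ≤ κ * (κ - 1) * ‖P‖ := by nlinarith [mul_pos (by linarith : 0 < κ) hp]
  have h4 : (κ - 1) * (2 * (κ + 1) * r₀) ≤ (κ - 1) * (κ * ‖P‖) := by nlinarith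
  have h5 := le_of_mul_le_mul_left h4 (by linarith)
  nlinarith

lemma axisParam_eq (κ : ℝ) (x₀ : Sph n) (P : Space n) (hs : 0 ≤ s) :
    axisParam κ x₀ P s = s + κ * ‖s • (x₀ : Space n) - P‖ :=
  opticalLength_smul κ x₀ P hs

lemma axisParam_zero (κ : ℝ) (x₀ : Sph n) (P : Space n) : axisParam κ x₀ P 0 = κ * ‖P‖ := by
  simp [axisParam, opticalLength]

lemma strictAntiOn_axisParam (S : AxisSetup κ τ r₀ r Ω D x₀) (hP : P ∈ D) :
    StrictAntiOn (axisParam κ x₀ P) (Icc 0 r₀) :=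
  (S.adm _ S.mem P hP).strictAntiOn

lemma mem_Icc (S : AxisSetup κ τ r₀ r Ω D x₀) (hs : s ∈ Icc 0 r) : s ∈ Icc 0 r₀ :=
  ⟨hs.1, by linarith [S.two_mul_le, hs.2, S.r_pos]⟩

lemma axisParam_le (S : AxisSetup κ τ r₀ r Ω D x₀) (hP : P ∈ D) (hs : s ∈ Icc 0 r) :
    axisParam κ x₀ P s ≤ κ * ‖P‖ := by
  rw [← axisParam_zero κ x₀ P]
  exact (S.strictAntiOn_axisParam hP).antitoneOn (S.mem_Icc ⟨le_rfl, S.r_pos.le⟩)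
    (S.mem_Icc hs) hs.1

lemma axisParam_lt (S : AxisSetup κ τ r₀ r Ω D x₀) (hP : P ∈ D) (hs : s ∈ Icc 0 r)
    (hs0 : 0 < s) : axisParam κ x₀ P s < κ * ‖P‖ := by
  rw [← axisParam_zero κ x₀ P]
  exact S.strictAntiOn_axisParam hP (S.mem_Icc ⟨le_rfl, S.r_pos.le⟩) (S.mem_Icc hs) hs0

lemma le_axisParam (S : AxisSetup κ τ r₀ r Ω D x₀) (hs : s ∈ Icc 0 r) :
    κ * ‖P‖ - (κ - 1) * s ≤ axisParam κ x₀ P s := by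
  rw [axisParam_eq κ x₀ P hs.1]
  have h1 : ‖P‖ - s ≤ ‖s • (x₀ : Space n) - P‖ := by
    have := norm_sub_norm_le P (s • (x₀ : Space n))
    rw [norm_smul, norm_sub_rev] at this
    simpa [abs_of_nonneg hs.1] using this
  nlinarith [S.one_lt]

lemma norm_lt_axisParam (S : AxisSetup κ τ r₀ r Ω D x₀) (hP : P ∈ D) (hs : s ∈ Icc 0 r) :
    ‖P‖ < axisParam κ x₀ P s := by
  have h1 := S.le_axisParam (P := P) hs
  have h2 := S.r₀_lt_norm hP
  have h3 := (S.mem_Icc hs).2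
  nlinarith [S.one_lt]

/-- `κ² |P|² - b²` is small for the ovals through the points `s x₀`, `s ≤ r`. -/
lemma sq_sub_sq_le (S : AxisSetup κ τ r₀ r Ω D x₀) (hP : P ∈ D) (hs : s ∈ Icc 0 r) :
    κ ^ 2 * ‖P‖ ^ 2 - axisParam κ x₀ P s ^ 2 ≤ κ ^ 2 * τ * ‖P‖ * r₀ := by
  have h1 := S.le_axisParam (P := P) hs
  have h2 := S.axisParam_le hP hs
  have hp := (S.adm _ S.mem P hP).norm_pos
  have h3 := S.norm_lt_axisParam hP hs
  have hκ := S.one_lt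
  set b := axisParam κ x₀ P s
  have h4 : κ * ‖P‖ - b ≤ (κ - 1) * r := by nlinarith [hs.2]
  have h5 : (κ * ‖P‖ - b) * (κ * ‖P‖ + b) ≤ ((κ - 1) * r) * (2 * κ * ‖P‖) :=
    mul_le_mul h4 (by linarith) (by nlinarith) (mul_nonneg (by linarith) S.r_pos.le)
  have h6 : 2 * (κ - 1) * r * (κ * ‖P‖) ≤ κ * τ * r₀ * (κ * ‖P‖) :=
    mul_le_mul_of_nonneg_right S.r_le (by positivity)
  linarith

lemma le_sub_axisParam (S : AxisSetup κ τ r₀ r Ω D x₀) (hP : P ∈ D) (hs : s ∈ Icc 0 r)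
    (hx : x ∈ closure Ω) :
    κ ^ 2 * τ * ‖P‖ ≤ κ ^ 2 * inner ℝ (x : Space n) P - axisParam κ x₀ P s := by
  have h1 := S.axisParam_le hP hs
  have h2 := mul_le_mul_of_nonneg_left (S.adm x hx P hP).angle (by linarith [S.one_lt] : 0 ≤ κ)
  nlinarith

lemma mem_ovalDirections (S : AxisSetup κ τ r₀ r Ω D x₀) (hP : P ∈ D) (hs : s ∈ Icc 0 r)
    (hx : x ∈ closure Ω) : x ∈ ovalDirections κ P (axisParam κ x₀ P s) := by
  obtain ⟨h1, hτ, hp, ha, hsm⟩ := S.adm x hx P hP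
  rw [mem_ovalDirections_iff (by positivity) hp.ne']
  refine le_trans ?_ (S.le_sub_axisParam hP hs hx)
  refine Real.sqrt_le_iff.2 ⟨by positivity, ?_⟩
  have hk : 0 < κ ^ 2 - 1 := by nlinarith
  have h2 := mul_le_mul_of_nonneg_left (S.sq_sub_sq_le hP hs) hk.le
  have h3 : κ ^ 2 * τ * ‖P‖ * (2 * (κ ^ 2 - 1) * r₀) ≤ κ ^ 2 * τ * ‖P‖ * (κ ^ 2 * τ * ‖P‖) := by
    gcongr
  nlinarith [sq_nonneg (κ ^ 2 * τ * ‖P‖)]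

lemma axisRadius_nonneg (S : AxisSetup κ τ r₀ r Ω D x₀) (hP : P ∈ D) (hs : s ∈ Icc 0 r)
    (hx : x ∈ closure Ω) : 0 ≤ axisRadius κ x₀ P s x :=
  (opticalLength_ovalRadius S.one_lt (S.adm x hx P hP).norm_pos (S.norm_lt_axisParam hP hs)
    (S.axisParam_le hP hs) (S.mem_ovalDirections hP hs hx)).1

lemma opticalLength_axisRadius (S : AxisSetup κ τ r₀ r Ω D x₀) (hP : P ∈ D) (hs : s ∈ Icc 0 r)
    (hx : x ∈ closure Ω) :
    opticalLength κ P (axisRadius κ x₀ P s x • (x : Space n)) = axisParam κ x₀ P s := by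
  rw [opticalLength_smul _ _ _ (S.axisRadius_nonneg hP hs hx)]
  exact (opticalLength_ovalRadius S.one_lt (S.adm x hx P hP).norm_pos (S.norm_lt_axisParam hP hs)
    (S.axisParam_le hP hs) (S.mem_ovalDirections hP hs hx)).2

/-- An oval which meets the axis at distance at most `r` stays within distance `r₀` of the origin
over `closure Ω`. -/
lemma axisRadius_le (S : AxisSetup κ τ r₀ r Ω D x₀) (hP : P ∈ D) (hs : s ∈ Icc 0 r)
    (hx : x ∈ closure Ω) : axisRadius κ x₀ P s x ≤ r₀ := by
  obtain ⟨h1, hτ, hp, ha, hsm⟩ := S.adm x hx P hP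
  have hd := ovalDiscrim_nonneg S.one_lt hp (S.norm_lt_axisParam hP hs)
    (S.axisParam_le hP hs) (S.mem_ovalDirections hP hs hx)
  have hm := ovalRadius_mul (P := P) (b := axisParam κ x₀ P s) (x := x) h1
  have hr := Real.sq_sqrt hd
  have hr0 := Real.sqrt_nonneg (ovalDiscrim κ P (axisParam κ x₀ P s) x)
  have hy := S.le_sub_axisParam hP hs hx
  have hC := S.sq_sub_sq_le hP hs
  have hk : 0 < κ ^ 2 - 1 := by nlinarith
  have hr₀ := S.r₀_pos
  have h0 := S.axisRadius_nonneg hP hs hx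
  change (κ ^ 2 - 1) * axisRadius κ x₀ P s x = _ at hm
  set h := axisRadius κ x₀ P s x
  set R := √(ovalDiscrim κ P (axisParam κ x₀ P s) x)
  rw [ovalDiscrim] at hr
  set y := κ ^ 2 * inner ℝ (x : Space n) P - axisParam κ x₀ P s
  have hypos : 0 < κ ^ 2 * τ * ‖P‖ := by positivity
  have h2 : (κ ^ 2 - 1) * (h * y) ≤ (κ ^ 2 - 1) * (r₀ * y) := by
    -- rationalize the numerator of `h`
    have h3 : ((κ ^ 2 - 1) * h) * (y + R) = (κ ^ 2 - 1) *
        (κ ^ 2 * ‖P‖ ^ 2 - axisParam κ x₀ P s ^ 2) := by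
      rw [hm]
      linear_combination -hr
    have h4 : 0 ≤ (κ ^ 2 - 1) * h * R := by positivity
    have h5 := mul_le_mul_of_nonneg_left hC hk.le
    have h6 : (κ ^ 2 - 1) * (κ ^ 2 * τ * ‖P‖ * r₀) ≤ (κ ^ 2 - 1) * (y * r₀) := by gcongr
    linarith
  exact le_of_mul_le_mul_right (le_of_mul_le_mul_left h2 hk) (hypos.trans_le hy)

lemma axisRadius_mem (S : AxisSetup κ τ r₀ r Ω D x₀) (hP : P ∈ D) (hs : s ∈ Icc 0 r)
    (hx : x ∈ closure Ω) : axisRadius κ x₀ P s x ∈ Icc 0 r₀ :=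
  ⟨S.axisRadius_nonneg hP hs hx, S.axisRadius_le hP hs hx⟩

lemma strictMonoOn_axisRadius (S : AxisSetup κ τ r₀ r Ω D x₀) (hP : P ∈ D)
    (hx : x ∈ closure Ω) : StrictMonoOn (fun s => axisRadius κ x₀ P s x) (Icc 0 r) := by
  intro s hs t ht hst
  refine ((S.adm x hx P hP).strictAntiOn.lt_iff_gt (S.axisRadius_mem hP ht hx)
    (S.axisRadius_mem hP hs hx)).1 ?_
  simp only [S.opticalLength_axisRadius hP hs hx, S.opticalLength_axisRadius hP ht hx]
  exact S.strictAntiOn_axisParam hP (S.mem_Icc hs) (S.mem_Icc ht) hst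

lemma axisRadius_self (S : AxisSetup κ τ r₀ r Ω D x₀) (hP : P ∈ D) (hs : s ∈ Icc 0 r) :
    axisRadius κ x₀ P s x₀ = s :=
  (S.strictAntiOn_axisParam hP).injOn (S.axisRadius_mem hP hs S.mem) (S.mem_Icc hs)
    (S.opticalLength_axisRadius hP hs S.mem)

lemma axisRadius_zero (S : AxisSetup κ τ r₀ r Ω D x₀) (hP : P ∈ D) (hx : x ∈ closure Ω) :
    axisRadius κ x₀ P 0 x = 0 := by
  have h0 : (0 : ℝ) ∈ Icc 0 r := ⟨le_rfl, S.r_pos.le⟩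
  refine (S.adm x hx P hP).strictAntiOn.injOn (S.axisRadius_mem hP h0 hx) (S.mem_Icc h0) ?_
  simp only [S.opticalLength_axisRadius hP h0 hx]
  simp [axisParam]

lemma axisRadius_pos (S : AxisSetup κ τ r₀ r Ω D x₀) (hP : P ∈ D) (hs : s ∈ Icc 0 r)
    (hs0 : 0 < s) (hx : x ∈ closure Ω) : 0 < axisRadius κ x₀ P s x := by
  rw [← S.axisRadius_zero hP hx]
  exact S.strictMonoOn_axisRadius hP hx ⟨le_rfl, S.r_pos.le⟩ hs hs0

/-- The two roots of the quadratic equation are separated. -/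
lemma ovalDiscrim_pos (S : AxisSetup κ τ r₀ r Ω D x₀) (hP : P ∈ D) (hs : s ∈ Icc 0 r)
    (hx : x ∈ closure Ω) : 0 < ovalDiscrim κ P (axisParam κ x₀ P s) x := by
  have hm := ovalRadius_mul (P := P) (b := axisParam κ x₀ P s) (x := x) S.one_lt
  have h1 := S.opticalLength_axisRadius hP hs hx
  rw [opticalLength_smul _ _ _ (S.axisRadius_nonneg hP hs hx)] at h1
  have h2 := (S.adm x hx P hP).norm_lt (S.axisRadius_le hP hs hx)
  change (κ ^ 2 - 1) * axisRadius κ x₀ P s x = _ at hm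
  refine Real.sqrt_pos.1 ?_
  have h3 := mul_lt_mul_of_pos_left h2 (by linarith [S.one_lt] : 0 < κ)
  linarith

lemma continuous_axisParam (κ : ℝ) (x₀ : Sph n) :
    Continuous fun y : Space n × ℝ => axisParam κ x₀ y.1 y.2 := by
  unfold axisParam opticalLength
  fun_prop

lemma continuous_axisRadius {X : Type*} [TopologicalSpace X] (κ : ℝ) (x₀ : Sph n)
    {p : X → Space n} {t : X → ℝ} {y : X → Sph n} (hp : Continuous p) (ht : Continuous t)
    (hy : Continuous y) : Continuous fun a => axisRadius κ x₀ (p a) (t a) (y a) := by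
  have h := (continuous_axisParam κ x₀).comp (hp.prodMk ht)
  simp only [Function.comp_def] at h
  unfold axisRadius ovalRadius
  fun_prop

/-- The polar radii of the ovals are Lipschitz functions on `closure Ω`, uniformly in the oval. -/
lemma exists_lipschitz (S : AxisSetup κ τ r₀ r Ω D x₀) :
    ∃ C : NNReal, ∀ P ∈ D, ∀ s ∈ Icc 0 r, LipschitzOnWith C (axisRadius κ x₀ P s) (closure Ω) := by
  -- compactness bounds the discriminant from below and the data from above
  have hcpt : IsCompact ((D ×ˢ Icc 0 r) ×ˢ closure Ω) :=
    (S.isCompact.prod isCompact_Icc).prod isClosed_closure.isCompact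
  have hb := continuous_axisParam κ x₀
  have hcont : Continuous fun y : (Space n × ℝ) × Sph n =>
      ovalDiscrim κ y.1.1 (axisParam κ x₀ y.1.1 y.1.2) y.2 := by
    have h := hb.comp (continuous_fst (X := Space n × ℝ) (Y := Sph n))
    simp only [Function.comp_def] at h
    unfold ovalDiscrim
    fun_prop
  obtain ⟨M, hM⟩ := S.isCompact.isBounded.exists_norm_le
  rcases ((D ×ˢ Icc 0 r) ×ˢ closure Ω).eq_empty_or_nonempty with hne | hne
  · refine ⟨0, fun P hP s hs => ?_⟩
    have : ((P, s), x₀) ∈ (D ×ˢ Icc 0 r) ×ˢ closure Ω := ⟨⟨hP, hs⟩, S.mem⟩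
    simp [hne] at this
  obtain ⟨z, hz, hzmin⟩ := hcpt.exists_isMinOn hne hcont.continuousOn
  have hd := S.ovalDiscrim_pos hz.1.1 hz.1.2 hz.2
  set d := ovalDiscrim κ z.1.1 (axisParam κ x₀ z.1.1 z.1.2) z.2
  have hM0 : 0 ≤ M := (norm_nonneg _).trans (hM _ hz.1.1)
  have hκ := S.one_lt
  have hk : 0 < κ ^ 2 - 1 := by nlinarith
  set A := (1 + κ ^ 2 * M / √d) * (κ ^ 2 * M) / (κ ^ 2 - 1)
  have hA : 0 ≤ A := by positivity
  refine ⟨⟨A, hA⟩, fun P hP s hs => LipschitzOnWith.of_dist_le_mul fun x hx x' hx' => ?_⟩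
  have hPM := hM P hP
  have hmin : ∀ x ∈ closure Ω, √d ≤ √(ovalDiscrim κ P (axisParam κ x₀ P s) x) := fun x hx =>
    Real.sqrt_le_sqrt (hzmin (a := ((P, s), x)) ⟨⟨hP, hs⟩, hx⟩)
  have hq : |inner ℝ (x : Space n) P - inner ℝ (x' : Space n) P| ≤ M * dist x x' := by
    rw [← inner_sub_left, Subtype.dist_eq, dist_eq_norm]
    calc _ ≤ _ := abs_real_inner_le_norm _ _
      _ = ‖P‖ * ‖(x : Space n) - x'‖ := mul_comm _ _
      _ ≤ _ := by gcongr
  have hm := ovalRadius_mul (P := P) (b := axisParam κ x₀ P s) (x := x) hκ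
  have hm' := ovalRadius_mul (P := P) (b := axisParam κ x₀ P s) (x := x') hκ
  have hr := Real.sq_sqrt (S.ovalDiscrim_pos hP hs hx).le
  have hr' := Real.sq_sqrt (S.ovalDiscrim_pos hP hs hx').le
  have hy := S.le_sub_axisParam hP hs hx
  have hy' := S.le_sub_axisParam hP hs hx'
  have hR := hmin x hx
  have hR' := hmin x' hx'
  have hqM := (inner_le_norm_of_sphere x P).trans hPM
  have hqM' := (inner_le_norm_of_sphere x' P).trans hPM
  have hbpos : 0 < axisParam κ x₀ P s :=
    (norm_nonneg _).trans_lt (S.norm_lt_axisParam hP hs)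
  have hpos : 0 ≤ κ ^ 2 * τ * ‖P‖ := by
    have := S.tau_pos
    positivity
  change (κ ^ 2 - 1) * axisRadius κ x₀ P s x = _ at hm
  change (κ ^ 2 - 1) * axisRadius κ x₀ P s x' = _ at hm'
  rw [Real.dist_eq]
  change _ ≤ A * _
  set h := axisRadius κ x₀ P s x
  set h' := axisRadius κ x₀ P s x'
  set R := √(ovalDiscrim κ P (axisParam κ x₀ P s) x)
  set R' := √(ovalDiscrim κ P (axisParam κ x₀ P s) x')
  rw [ovalDiscrim] at hr hr'
  set q := inner ℝ (x : Space n) P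
  set q' := inner ℝ (x' : Space n) P
  set b := axisParam κ x₀ P s
  have hsd : 0 < √d := Real.sqrt_pos.2 hd
  -- difference of the square roots
  have hRR : |R - R'| ≤ κ ^ 2 * M / √d * (κ ^ 2 * |q - q'|) := by
    have h1 : |R - R'| * (R + R') = κ ^ 2 * |q - q'| * (κ ^ 2 * q - b + (κ ^ 2 * q' - b)) := by
      rw [← abs_of_nonneg (by linarith : 0 ≤ R + R'),
        ← abs_of_nonneg (by linarith : 0 ≤ κ ^ 2 * q - b + (κ ^ 2 * q' - b)),
        ← abs_of_nonneg (by positivity : 0 ≤ κ ^ 2), ← abs_mul, ← abs_mul, ← abs_mul]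
      congr 1
      rw [abs_of_nonneg (by positivity : 0 ≤ κ ^ 2)]
      linear_combination hr - hr'
    have h2 : |R - R'| * (2 * √d) ≤ |R - R'| * (R + R') := by
      gcongr
      linarith
    have h3 : κ ^ 2 * |q - q'| * (κ ^ 2 * q - b + (κ ^ 2 * q' - b))
        ≤ κ ^ 2 * |q - q'| * (2 * (κ ^ 2 * M)) := by
      gcongr
      nlinarith [sq_nonneg κ]
    rw [div_mul_eq_mul_div, le_div_iff₀ hsd]
    linarith
  have hfin : (κ ^ 2 - 1) * |h - h'| ≤ (1 + κ ^ 2 * M / √d) * (κ ^ 2 * |q - q'|) := by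
    rw [← abs_of_pos hk, ← abs_mul]
    have : (κ ^ 2 - 1) * (h - h') = κ ^ 2 * (q - q') - (R - R') := by linarith
    rw [this]
    calc _ ≤ |κ ^ 2 * (q - q')| + |R - R'| := abs_sub _ _
      _ = κ ^ 2 * |q - q'| + |R - R'| := by rw [abs_mul, abs_of_nonneg (sq_nonneg κ)]
      _ ≤ _ := by linarith
  have hfin' : (1 + κ ^ 2 * M / √d) * (κ ^ 2 * |q - q'|)
      ≤ (1 + κ ^ 2 * M / √d) * (κ ^ 2 * (M * dist x x')) := by gcongr
  have : A * dist x x' = (1 + κ ^ 2 * M / √d) * (κ ^ 2 * (M * dist x x')) / (κ ^ 2 - 1) := by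
    simp only [A]
    ring
  rw [this, le_div_iff₀ hk]
  linarith

end AxisSetup

/-! ### Almost everywhere uniqueness of the refracted target -/

/-- The extension of a function on the sphere to a function on `ℝⁿ` that is constant along rays;
its value at the origin is irrelevant. -/
def radialExt {n : ℕ} (ρ : Sph n → ℝ) (Z : Space n) : ℝ :=
  open Classical in
  if h : Z ≠ 0 then ρ ⟨‖Z‖⁻¹ • Z, by simp [norm_smul, h]⟩ else 0

lemma radialExt_smul {n : ℕ} (ρ : Sph n → ℝ) (x : Sph n) {t : ℝ} (ht : 0 < t) :
    radialExt ρ (t • (x : Space n)) = ρ x := by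
  have hx : (x : Space n) ≠ 0 := ne_zero_of_mem_unit_sphere x
  rw [radialExt, dif_pos (smul_ne_zero ht.ne' hx)]
  congr 1
  ext1
  simp [norm_smul, abs_of_pos ht, smul_smul, ht.ne']

lemma norm_inv_smul_sub_le {E : Type*} [NormedAddCommGroup E] [NormedSpace ℝ E] {Z W : E}
    (hZ : 1 ≤ ‖Z‖) (hW : W ≠ 0) : ‖‖Z‖⁻¹ • Z - ‖W‖⁻¹ • W‖ ≤ 2 * ‖Z - W‖ := by
  have hZ0 : 0 < ‖Z‖ := by linarith
  have hW0 : 0 < ‖W‖ := norm_pos_iff.2 hW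
  have h1 : ‖Z‖⁻¹ • Z - ‖W‖⁻¹ • W = ‖Z‖⁻¹ • (Z - W) + (‖Z‖⁻¹ - ‖W‖⁻¹) • W := by
    rw [smul_sub, sub_smul]
    abel
  have h2 : ‖(‖Z‖⁻¹ - ‖W‖⁻¹) • W‖ ≤ ‖Z‖⁻¹ * ‖Z - W‖ := by
    rw [norm_smul, Real.norm_eq_abs, inv_sub_inv hZ0.ne' hW0.ne', abs_div,
      abs_of_pos (mul_pos hZ0 hW0), abs_sub_comm]
    have := abs_norm_sub_norm_le Z W
    rw [div_mul_eq_mul_div, mul_div_mul_right _ _ hW0.ne', div_eq_inv_mul]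
    gcongr
  have h3 : ‖Z‖⁻¹ ≤ 1 := inv_le_one_of_one_le₀ hZ
  calc _ ≤ ‖‖Z‖⁻¹ • (Z - W)‖ + ‖(‖Z‖⁻¹ - ‖W‖⁻¹) • W‖ := by rw [h1]; exact norm_add_le _ _
    _ ≤ ‖Z‖⁻¹ * ‖Z - W‖ + ‖Z‖⁻¹ * ‖Z - W‖ := by
        gcongr
        rw [norm_smul, norm_inv, norm_norm]
    _ ≤ 1 * ‖Z - W‖ + 1 * ‖Z - W‖ := by gcongr
    _ = _ := by ring

/-- Rademacher's theorem on the sphere: almost every ray in the cone over `Ω` contains a point of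
differentiability of the radial extension of a Lipschitz function on `Ω`. -/
theorem ae_exists_differentiableAt_radialExt {n : ℕ} {Ω : Set (Sph n)} (hΩ : IsOpen Ω)
    {ρ : Sph n → ℝ} {C : NNReal} (hρ : LipschitzOnWith C ρ Ω) :
    ∀ᵐ x ∂(surf n), x ∈ Ω → ∃ t : ℝ, 0 < t ∧
      DifferentiableAt ℝ (radialExt ρ) (t • (x : Space n)) := by
  set e := homeomorphUnitSphereProd (Space n)
  set T : Set (Sph n × Ioi (0 : ℝ)) := Ω ×ˢ Ioi ⟨1, mem_Ioi.2 one_pos⟩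
  have hT : IsOpen T := hΩ.prod isOpen_Ioi
  set s : Set (Space n) := Subtype.val '' (e ⁻¹' T)
  have hs : IsOpen s :=
    isOpen_compl_singleton.isOpenMap_subtype_val _ (e.continuous.isOpen_preimage _ hT)
  have hsmem : ∀ Z ∈ s, ∃ (y : Sph n) (t : ℝ), y ∈ Ω ∧ 1 < t ∧ Z = t • (y : Space n) := by
    rintro _ ⟨z, hz, rfl⟩
    refine ⟨(e z).1, (e z).2, hz.1, hz.2, ?_⟩
    have hz0 : (z : Space n) ≠ 0 := z.2
    simp [e, smul_smul, hz0]
  have hlip : LipschitzOnWith (C * 2) (radialExt ρ) s := by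
    refine LipschitzOnWith.of_dist_le_mul fun Z hZ W hW => ?_
    obtain ⟨y, t, hy, ht, rfl⟩ := hsmem Z hZ
    obtain ⟨y', t', hy', ht', rfl⟩ := hsmem W hW
    have ht0 : 0 < t := by linarith
    have ht0' : 0 < t' := by linarith
    rw [radialExt_smul ρ y ht0, radialExt_smul ρ y' ht0']
    refine (hρ.dist_le_mul y hy y' hy').trans ?_
    have h1 := norm_inv_smul_sub_le (Z := t • (y : Space n)) (W := t' • (y' : Space n))
      (by simpa [norm_smul, abs_of_pos ht0] using ht.le)
      (smul_ne_zero ht0'.ne' (ne_zero_of_mem_unit_sphere y'))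
    simp only [norm_smul, Real.norm_eq_abs, abs_of_pos ht0, abs_of_pos ht0',
      norm_eq_of_mem_sphere, mul_one, smul_smul, inv_mul_cancel₀ ht0.ne', one_smul,
      inv_mul_cancel₀ ht0'.ne'] at h1
    rw [Subtype.dist_eq, dist_eq_norm, dist_eq_norm]
    push_cast
    rw [mul_assoc]
    gcongr
  have hae : ∀ᵐ Z ∂(volume : Measure (Space n)), Z ∈ s → DifferentiableAt ℝ (radialExt ρ) Z := by
    filter_upwards [hlip.ae_differentiableWithinAt_of_mem (μ := volume)] with Z hZ hZs
    exact (hZ hZs).differentiableAt (hs.mem_nhds hZs)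
  have hmp := (volume : Measure (Space n)).measurePreserving_homeomorphUnitSphereProd
  have hemb := MeasurableEmbedding.subtype_coe (measurableSet_singleton (0 : Space n)).compl
  have hae1 := ae_restrict_of_ae (s := {(0 : Space n)}ᶜ) hae
  rw [← map_comap_subtype_coe (measurableSet_singleton (0 : Space n)).compl,
    hemb.ae_map_iff] at hae1
  have hae2 : ∀ᵐ p ∂((volume : Measure (Space n)).toSphere.prod
      (Measure.volumeIoiPow (Module.finrank ℝ (Space n) - 1))),
      ((e.symm p : ({0}ᶜ : Set (Space n))) : Space n) ∈ s →
        DifferentiableAt ℝ (radialExt ρ) (e.symm p : Space n) := by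
    rw [← hmp.map_eq]
    refine e.measurableEmbedding.ae_map_iff.2 ?_
    simpa using hae1
  filter_upwards [Measure.ae_ae_of_ae_prod hae2] with x hx hxΩ
  set k := Module.finrank ℝ (Space n) - 1
  -- the rays carry a measure which charges `(1, ∞)`
  have hfreq : ∃ᵐ t ∂(Measure.volumeIoiPow k), ⟨1, mem_Ioi.2 one_pos⟩ < t := by
    intro hcon
    have h1 : Measure.volumeIoiPow k (Iio ⟨3, mem_Ioi.2 (by norm_num)⟩)
        ≤ Measure.volumeIoiPow k (Iio ⟨2, mem_Ioi.2 (by norm_num)⟩) := by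
      refine measure_mono_ae ?_
      filter_upwards [hcon] with t ht _
      exact lt_of_le_of_lt (not_lt.1 ht) (Subtype.mk_lt_mk.2 (by norm_num))
    rw [Measure.volumeIoiPow_apply_Iio, Measure.volumeIoiPow_apply_Iio,
      ENNReal.ofReal_le_ofReal_iff (by positivity)] at h1
    have h2 : (2 : ℝ) ^ (k + 1) < 3 ^ (k + 1) :=
      pow_lt_pow_left₀ (by norm_num) (by norm_num) (by simp)
    exact absurd h1 (not_le.2 (div_lt_div_of_pos_right h2 (by positivity)))
  obtain ⟨t, ht1, ht⟩ := (hfreq.and_eventually hx).exists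
  have hval : ((e.symm (x, t) : ({0}ᶜ : Set (Space n))) : Space n) = (t : ℝ) • (x : Space n) := by
    simp [e]
  refine ⟨t, t.2, ?_⟩
  rw [← hval]
  exact ht ⟨e.symm (x, t), by simp [T, hxΩ, ht1], rfl⟩

/-- The great circle through `x` in the direction of the unit tangent vector `e`. -/
def sphArc {n : ℕ} (x : Sph n) (e : Space n) (he : ‖e‖ = 1)
    (hxe : inner ℝ (x : Space n) e = 0) (ε : ℝ) : Sph n :=
  ⟨Real.cos ε • (x : Space n) + Real.sin ε • e, by
    have h : ‖Real.cos ε • (x : Space n) + Real.sin ε • e‖ ^ 2 = 1 := by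
      rw [norm_add_sq_real]
      simp [norm_smul, inner_smul_left, inner_smul_right, hxe, he]
    rw [mem_sphere_zero_iff_norm]
    exact (pow_eq_one_iff_of_nonneg (norm_nonneg _) two_ne_zero).1 h⟩

section Arc

variable {n : ℕ} {x : Sph n} {e : Space n} {he : ‖e‖ = 1} {hxe : inner ℝ (x : Space n) e = 0}

lemma coe_sphArc (ε : ℝ) : (sphArc x e he hxe ε : Space n)
    = Real.cos ε • (x : Space n) + Real.sin ε • e := rfl

lemma sphArc_zero : sphArc x e he hxe 0 = x := by
  ext1
  simp [coe_sphArc]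

lemma continuous_sphArc : Continuous (sphArc x e he hxe) := by
  refine Continuous.subtype_mk ?_ _
  fun_prop

lemma hasDerivAt_sphArc :
    HasDerivAt (fun ε => (sphArc x e he hxe ε : Space n)) e 0 := by
  have h := ((Real.hasDerivAt_cos 0).smul_const (x : Space n)).add
    ((Real.hasDerivAt_sin 0).smul_const e)
  simp only [Real.sin_zero, neg_zero, zero_smul, Real.cos_zero, one_smul, zero_add] at h
  exact h

/-- Differentiability at one point of a ray gives tangential derivatives in its direction. -/
lemma exists_hasDerivAt_sphArc {ρ : Sph n → ℝ} {t : ℝ} (ht : 0 < t)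
    (h : DifferentiableAt ℝ (radialExt ρ) (t • (x : Space n))) :
    ∃ g, HasDerivAt (fun ε => ρ (sphArc x e he hxe ε)) g 0 := by
  have h1 : HasDerivAt (fun ε => t • (sphArc x e he hxe ε : Space n)) (t • e) 0 :=
    hasDerivAt_sphArc.const_smul t
  have h2 : HasFDerivAt (radialExt ρ) (fderiv ℝ (radialExt ρ) (t • (x : Space n)))
      (t • (sphArc x e he hxe 0 : Space n)) := by
    rw [sphArc_zero]
    exact h.hasFDerivAt
  have h3 := h2.comp_hasDerivAt (0 : ℝ) h1
  refine ⟨_, h3.congr_of_eventuallyEq (Filter.Eventually.of_forall fun ε => ?_)⟩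
  simp [radialExt_smul ρ _ ht]

end Arc

section Support

variable {n : ℕ} {κ τ r₀ b : ℝ} {Ω : Set (Sph n)} {D : Set (Space n)} {ρ : Sph n → ℝ}
  {P : Space n} {x y : Sph n}

/-- An oval that supports a surface from below has the surface in its interior. -/
lemma IsSupportingOval.mul_norm_le (h : IsSupportingOval κ Ω ρ P b y)
    (hadm : IsAdmissible κ τ r₀ x P) (hx : x ∈ closure Ω) (hρ : ρ x ≤ r₀) :
    κ * ‖ρ x • (x : Space n) - P‖ ≤ b - ρ x := by
  obtain ⟨h0, h1⟩ := opticalLength_ovalRadius hadm.one_lt hadm.norm_pos h.lt_b h.b_lt.le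
    (h.directions hx)
  have hle := h.le x hx
  have h2 := hadm.strictAntiOn.antitoneOn ⟨h0, hle.trans hρ⟩ ⟨h0.trans hle, hρ⟩ hle
  simp only [opticalLength_smul _ _ _ h0, opticalLength_smul _ _ _ (h0.trans hle)] at h2
  linarith

lemma IsSupportingOval.mul_norm_eq (h : IsSupportingOval κ Ω ρ P b y)
    (hadm : IsAdmissible κ τ r₀ y P) (hy : y ∈ closure Ω) :
    κ * ‖ρ y • (y : Space n) - P‖ = b - ρ y := by
  obtain ⟨h0, h1⟩ := opticalLength_ovalRadius hadm.one_lt hadm.norm_pos h.lt_b h.b_lt.le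
    (h.directions hy)
  rw [h.eq]
  linarith

/-- The law of refraction: the derivative of `ρ` at a point of contact with an oval is that of
the oval. -/
lemma IsSupportingOval.deriv_eq (h : IsSupportingOval κ Ω ρ P b x)
    (hadm : ∀ y ∈ closure Ω, IsAdmissible κ τ r₀ y P) (hΩ : IsOpen Ω) (hx : x ∈ Ω)
    (hρ : ∀ y ∈ closure Ω, ρ y ≤ r₀) {e : Space n} {he : ‖e‖ = 1}
    {hxe : inner ℝ (x : Space n) e = 0} {g : ℝ}
    (hg : HasDerivAt (fun ε => ρ (sphArc x e he hxe ε)) g 0) :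
    (κ * (inner ℝ (x : Space n) P - ρ x) - ‖ρ x • (x : Space n) - P‖) * g
      = -(κ * ρ x * inner ℝ e P) := by
  have hxc := subset_closure hx
  have hκ := (hadm x hxc).one_lt
  have heq := h.mul_norm_eq (hadm x hxc) hxc
  set γ := sphArc x e he hxe
  -- the defining inequality of the interior of the oval, with the square root removed
  let Ψ : ℝ → ℝ := fun ε =>
    κ ^ 2 * (ρ (γ ε) ^ 2 - 2 * ρ (γ ε) * inner ℝ (γ ε : Space n) P + ‖P‖ ^ 2) - (b - ρ (γ ε)) ^ 2
  have hΨ : ∀ ε, Ψ ε = (κ * ‖ρ (γ ε) • (γ ε : Space n) - P‖) ^ 2 - (b - ρ (γ ε)) ^ 2 := by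
    intro ε
    rw [mul_pow, norm_smul_sub_sq]
  have hmax : IsLocalMax Ψ 0 := by
    have hev : ∀ᶠ ε in nhds (0 : ℝ), γ ε ∈ Ω := by
      refine continuous_sphArc.continuousAt.eventually_mem (hΩ.mem_nhds ?_)
      rwa [sphArc_zero]
    filter_upwards [hev] with ε hε
    have h1 := h.mul_norm_le (hadm _ (subset_closure hε)) (subset_closure hε)
      (hρ _ (subset_closure hε))
    have h0 : Ψ 0 = 0 := by
      rw [hΨ]
      simp only [γ, sphArc_zero, heq, sub_self]
    rw [h0, hΨ]
    have := pow_le_pow_left₀ (by positivity) h1 2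
    linarith
  have hin : HasDerivAt (fun ε => inner ℝ (γ ε : Space n) P) (inner ℝ e P) 0 := by
    have := (hasDerivAt_sphArc (x := x) (he := he) (hxe := hxe)).inner ℝ (hasDerivAt_const 0 P)
    simpa using this
  have hder := (((hg.pow 2).sub ((hg.const_mul 2).mul hin)).add_const (‖P‖ ^ 2)).const_mul (κ ^ 2)
    |>.sub ((hg.const_sub b).pow 2)
  have hz := hmax.hasDerivAt_eq_zero hder
  have : κ * ((κ * (inner ℝ (x : Space n) P - ρ x) - ‖ρ x • (x : Space n) - P‖) * g)
      = κ * (-(κ * ρ x * inner ℝ e P)) := by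
    have hγ : γ 0 = x := sphArc_zero
    rw [hγ] at hz
    push_cast at hz
    linear_combination (-1 / 2) * hz - g * heq
  exact mul_left_cancel₀ (by positivity) this

/-- The polar angle of the refracted ray is determined by the tangential derivative: the function
`(1 - α²) / (κ α - 1)²` is strictly decreasing for `1 / κ < α ≤ 1`. -/
lemma cos_eq_of_refraction {κ α α' : ℝ} (hκ : 0 < κ) (hα : 1 < κ * α) (hα' : 1 < κ * α')
    (h1 : α ^ 2 ≤ 1) (h1' : α' ^ 2 ≤ 1)
    (h : (κ * α' - 1) ^ 2 * (1 - α ^ 2) = (κ * α - 1) ^ 2 * (1 - α' ^ 2)) : α = α' := by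
  have key : ∀ {β β' : ℝ}, 1 < κ * β → β' ^ 2 ≤ 1 →
      (κ * β' - 1) ^ 2 * (1 - β ^ 2) = (κ * β - 1) ^ 2 * (1 - β' ^ 2) → ¬ β < β' := by
    intro β β' hβ hβ' heq hlt
    have hβ0 : 0 < β := by
      by_contra h0
      nlinarith
    have h2 : κ * β < κ * β' := by gcongr
    have h3 : (κ * β - 1) ^ 2 < (κ * β' - 1) ^ 2 :=
      pow_lt_pow_left₀ (by linarith) (by linarith) two_ne_zero
    have h4 : β ^ 2 < β' ^ 2 := pow_lt_pow_left₀ hlt hβ0.le two_ne_zero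
    have h5 : (κ * β - 1) ^ 2 * (1 - β' ^ 2) ≤ (κ * β' - 1) ^ 2 * (1 - β' ^ 2) :=
      mul_le_mul_of_nonneg_right h3.le (by linarith)
    have h6 : (κ * β' - 1) ^ 2 * (1 - β' ^ 2) < (κ * β' - 1) ^ 2 * (1 - β ^ 2) :=
      mul_lt_mul_of_pos_left (by linarith) (by nlinarith [sq_nonneg (κ * β - 1)])
    linarith
  exact le_antisymm (not_lt.1 (key hα' h1 h.symm)) (not_lt.1 (key hα h1' h))

/-- Two ovals that touch `ρ` from below at a point of differentiability refract the incoming ray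
in the same direction, so that by the visibility condition their foci coincide. -/
theorem IsSupportingOval.focus_eq {P' : Space n} {b' : ℝ} (h : IsSupportingOval κ Ω ρ P b x)
    (h' : IsSupportingOval κ Ω ρ P' b' x)
    (hadm : ∀ y ∈ closure Ω, ∀ P ∈ D, IsAdmissible κ τ r₀ y P)
    (hvis : ∀ X ∈ cone Ω r₀, ∀ m : Space n, ‖m‖ = 1 → (D ∩ ray X m).Subsingleton)
    (hΩ : IsOpen Ω) (hx : x ∈ Ω) (hρ : ∀ y ∈ closure Ω, ρ y ≤ r₀) (hρ0 : 0 < ρ x)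
    (hP : P ∈ D) (hP' : P' ∈ D)
    (hd : ∃ t : ℝ, 0 < t ∧ DifferentiableAt ℝ (radialExt ρ) (t • (x : Space n))) : P = P' := by
  obtain ⟨t, ht, hd⟩ := hd
  have hxc := subset_closure hx
  have ha := hadm x hxc P hP
  have ha' := hadm x hxc P' hP'
  have hκ := ha.one_lt
  have hΛ := ha.norm_lt (hρ x hxc)
  have hΛ' := ha'.norm_lt (hρ x hxc)
  have hN := ha.norm_pos_of_le (hρ x hxc)
  have hN' := ha'.norm_pos_of_le (hρ x hxc)
  have hN2 := norm_smul_sub_sq x P (ρ x)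
  have hN2' := norm_smul_sub_sq x P' (ρ x)
  have hder := fun (e : Space n) (he : ‖e‖ = 1) (hxe : inner ℝ (x : Space n) e = 0) (g : ℝ)
    (hg : HasDerivAt (fun ε => ρ (sphArc x e he hxe ε)) g 0) =>
    h.deriv_eq (fun y hy => hadm y hy P hP) hΩ hx hρ hg
  have hder' := fun (e : Space n) (he : ‖e‖ = 1) (hxe : inner ℝ (x : Space n) e = 0) (g : ℝ)
    (hg : HasDerivAt (fun ε => ρ (sphArc x e he hxe ε)) g 0) =>
    h'.deriv_eq (fun y hy => hadm y hy P' hP') hΩ hx hρ hg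
  set N := ‖ρ x • (x : Space n) - P‖ with hNdef
  set N' := ‖ρ x • (x : Space n) - P'‖
  set q := inner ℝ (x : Space n) P with hq
  set q' := inner ℝ (x : Space n) P' with hq'
  set Λ := κ * (q - ρ x) - N with hΛdef
  set Λ' := κ * (q' - ρ x) - N' with hΛdef'
  set T := P - q • (x : Space n) with hT
  set T' := P' - q' • (x : Space n) with hT'
  have hxx : inner ℝ (x : Space n) (x : Space n) = 1 := by simp
  have hxT : inner ℝ (x : Space n) T = 0 := by
    rw [hT, inner_sub_right, inner_smul_right, hxx, mul_one, sub_self]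
  have hxT' : inner ℝ (x : Space n) T' = 0 := by
    rw [hT', inner_sub_right, inner_smul_right, hxx, mul_one, sub_self]
  -- the tangential components of the refracted rays are proportional
  have hz : Λ' • T - Λ • T' = 0 := by
    by_contra hz0
    set z := Λ' • T - Λ • T' with hzdef
    have hnz : ‖z‖ ≠ 0 := norm_ne_zero_iff.2 hz0
    have hxz : inner ℝ (x : Space n) z = 0 := by
      rw [hzdef, inner_sub_right, inner_smul_right, inner_smul_right, hxT, hxT']
      ring
    have he : ‖‖z‖⁻¹ • z‖ = 1 := by simp [norm_smul, hnz]
    have hxe : inner ℝ (x : Space n) (‖z‖⁻¹ • z) = 0 := by rw [inner_smul_right, hxz, mul_zero]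
    obtain ⟨g, hg⟩ := exists_hasDerivAt_sphArc (he := he) (hxe := hxe) ht hd
    have e1 := hder _ he hxe g hg
    have e2 := hder' _ he hxe g hg
    have hzx : inner ℝ z (x : Space n) = 0 := by rw [real_inner_comm, hxz]
    have e3 : inner ℝ z z = Λ' * inner ℝ z P - Λ * inner ℝ z P' := by
      conv_lhs => rw [hzdef]
      rw [← hzdef, inner_sub_right, inner_smul_right, inner_smul_right, hT, hT',
        inner_sub_right, inner_sub_right, inner_smul_right, inner_smul_right, hzx]
      ring
    rw [inner_smul_left] at e1 e2
    simp only [map_inv₀, conj_trivial] at e1 e2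
    have e4 : κ * ρ x * ‖z‖⁻¹ * (Λ' * inner ℝ z P - Λ * inner ℝ z P') = 0 := by
      linear_combination Λ' * e1 - Λ * e2
    rw [← e3, real_inner_self_eq_norm_sq] at e4
    have : κ * ρ x * ‖z‖⁻¹ * ‖z‖ ^ 2 ≠ 0 := by positivity
    exact this e4
  rw [sub_eq_zero] at hz
  have hTn : ‖T‖ ^ 2 = N ^ 2 - (q - ρ x) ^ 2 := by
    rw [hT, norm_sub_rev, norm_smul_sub_sq, hN2]
    ring
  have hTn' : ‖T'‖ ^ 2 = N' ^ 2 - (q' - ρ x) ^ 2 := by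
    rw [hT', norm_sub_rev, norm_smul_sub_sq, hN2']
    ring
  have hΛ0 : 0 < Λ := by linarith
  have hΛ0' : 0 < Λ' := by linarith
  have hsq : Λ' ^ 2 * ‖T‖ ^ 2 = Λ ^ 2 * ‖T'‖ ^ 2 := by
    have := congrArg (fun v => ‖v‖ ^ 2) hz
    simpa [norm_smul, mul_pow] using this
  set α := (q - ρ x) / N with hα
  set α' := (q' - ρ x) / N' with hα'
  have hqN : q - ρ x = N * α := by rw [hα]; field_simp
  have hqN' : q' - ρ x = N' * α' := by rw [hα']; field_simp
  have hΛα : Λ = N * (κ * α - 1) := by rw [hΛdef, hqN]; ring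
  have hΛα' : Λ' = N' * (κ * α' - 1) := by rw [hΛdef', hqN']; ring
  have hcα : 0 < κ * α - 1 := by
    rw [hΛα] at hΛ0
    exact (pos_iff_pos_of_mul_pos hΛ0).1 hN
  have hcα' : 0 < κ * α' - 1 := by
    rw [hΛα'] at hΛ0'
    exact (pos_iff_pos_of_mul_pos hΛ0').1 hN'
  have hTα : ‖T‖ ^ 2 = N ^ 2 * (1 - α ^ 2) := by rw [hTn, hqN]; ring
  have hTα' : ‖T'‖ ^ 2 = N' ^ 2 * (1 - α' ^ 2) := by rw [hTn', hqN']; ring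
  have hαα : α = α' := by
    refine cos_eq_of_refraction (κ := κ) (by linarith) (by linarith) (by linarith) ?_ ?_ ?_
    · have : 0 ≤ N ^ 2 * (1 - α ^ 2) := hTα ▸ sq_nonneg _
      linarith [nonneg_of_mul_nonneg_right this (by positivity)]
    · have : 0 ≤ N' ^ 2 * (1 - α' ^ 2) := hTα' ▸ sq_nonneg _
      linarith [nonneg_of_mul_nonneg_right this (by positivity)]
    · have : (N ^ 2 * N' ^ 2) * ((κ * α' - 1) ^ 2 * (1 - α ^ 2))
          = (N ^ 2 * N' ^ 2) * ((κ * α - 1) ^ 2 * (1 - α' ^ 2)) := by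
        rw [hTα, hTα', hΛα, hΛα'] at hsq
        linear_combination hsq
      exact mul_left_cancel₀ (by positivity) this
  have hNT : N' • T = N • T' := by
    have : (κ * α - 1) • (N' • T) = (κ * α - 1) • (N • T') := by
      rw [smul_smul, smul_smul]
      rw [hΛα, hΛα', ← hαα] at hz
      rw [mul_comm _ N', mul_comm _ N]
      exact hz
    exact smul_right_injective _ hcα.ne' this
  have hprop : N' • (P - ρ x • (x : Space n)) = N • (P' - ρ x • (x : Space n)) := by
    have e1 : P - ρ x • (x : Space n) = (N * α) • (x : Space n) + T := by
      rw [← hqN, hT, sub_smul]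
      abel
    have e2 : P' - ρ x • (x : Space n) = (N' * α) • (x : Space n) + T' := by
      rw [hαα, ← hqN', hT', sub_smul]
      abel
    rw [e1, e2, smul_add, smul_add, hNT, smul_smul, smul_smul]
    congr 2
    ring
  refine hvis (ρ x • (x : Space n)) ⟨x, hxc, ρ x, hρ0, hρ x hxc, rfl⟩
    (N⁻¹ • (P - ρ x • (x : Space n))) ?_ ⟨hP, N, hN.le, ?_⟩ ⟨hP', N', hN'.le, ?_⟩
  · rw [norm_smul, norm_sub_rev, ← hNdef, norm_inv, Real.norm_of_nonneg hN.le,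
      inv_mul_cancel₀ hN.ne']
  · rw [smul_smul, mul_inv_cancel₀ hN.ne', one_smul]
    abel
  · rw [smul_comm, hprop, smul_smul, inv_mul_cancel₀ hN.ne', one_smul]
    abel

/-- Almost every ray is refracted towards at most one target point. -/
theorem ae_refractorMap_subsingleton
    (hadm : ∀ y ∈ closure Ω, ∀ P ∈ D, IsAdmissible κ τ r₀ y P)
    (hvis : ∀ X ∈ cone Ω r₀, ∀ m : Space n, ‖m‖ = 1 → (D ∩ ray X m).Subsingleton)
    (hΩ : IsOpen Ω) (hρ : ∀ y ∈ closure Ω, ρ y ≤ r₀) (hρ0 : ∀ y ∈ closure Ω, 0 < ρ y)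
    {C : NNReal} (hlip : LipschitzOnWith C ρ (closure Ω)) :
    ∀ᵐ x ∂(surf n), x ∈ Ω → (refractorMap κ Ω D ρ x).Subsingleton := by
  filter_upwards [ae_exists_differentiableAt_radialExt hΩ (hlip.mono subset_closure)]
    with x hx hxΩ P hP P' hP'
  obtain ⟨b, hb⟩ := hP
  obtain ⟨b', hb'⟩ := hP'
  exact Subtype.ext (hb.focus_eq hb' hadm hvis hΩ hxΩ hρ (hρ0 x (subset_closure hxΩ)) P.2 P'.2
    (hx hxΩ))

end Support

/-! ### Semi-discrete problem for a monotone family of functions -/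

section Cells

/-- The set of points at which `H i (s i)` is the largest of the functions `H j (s j)`. -/
def cell {X ι : Type*} (H : ι → ℝ → X → ℝ) (s : ι → ℝ) (i : ι) : Set X :=
  {x | ∀ j, H j (s j) x ≤ H i (s i) x}

lemma exists_mem_cell {X ι : Type*} [Finite ι] [Nonempty ι] (H : ι → ℝ → X → ℝ)
    (s : ι → ℝ) (x : X) :
    ∃ i, x ∈ cell H s i :=
  Finite.exists_max fun j => H j (s j) x

variable {X ι : Type*} [MeasurableSpace X] {ν : Measure X}
  {H : ι → ℝ → X → ℝ} {r : ℝ} {s s' : ι → ℝ} {i : ι}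

/-- A finite family of functions `H i s`, continuous and strictly increasing in the parameter
`s ∈ [0, r]` and vanishing at `s = 0`, no two of which are jointly maximal on a set of positive
measure. -/
structure IsMonotoneFamily (ν : Measure X) (H : ι → ℝ → X → ℝ) (r : ℝ) : Prop where
  measurable : ∀ i s, Measurable (H i s)
  continuous : ∀ i x, Continuous fun s => H i s x
  strictMono : ∀ᵐ x ∂ν, ∀ i, StrictMonoOn (fun s => H i s x) (Icc 0 r)
  zero : ∀ᵐ x ∂ν, ∀ i, H i 0 x = 0
  tie : ∀ s ∈ Icc (0 : ι → ℝ) (fun _ => r), s ≠ 0 →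
    ∀ᵐ x ∂ν, ∀ i j, x ∈ cell H s i → x ∈ cell H s j → i = j

open Classical in
lemma update_mem_Icc {ι : Type*} {r : ℝ} {s : ι → ℝ} (hs : s ∈ Icc (0 : ι → ℝ) (fun _ => r))
    (i : ι) {t : ℝ} (ht : t ∈ Icc 0 r) : Function.update s i t ∈ Icc (0 : ι → ℝ) (fun _ => r) :=
  ⟨le_update_iff.2 ⟨ht.1, fun j _ => hs.1 j⟩, update_le_iff.2 ⟨ht.2, fun j _ => hs.2 j⟩⟩

namespace IsMonotoneFamily

lemma measurableSet_cell [Countable ι] (hH : IsMonotoneFamily ν H r) (s : ι → ℝ) (i : ι) :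
    MeasurableSet (cell H s i) := by
  simp only [cell, ofPred_forall]
  exact MeasurableSet.iInter fun j =>
    measurableSet_le (hH.measurable j (s j)) (hH.measurable i (s i))

lemma sum_measureReal_cell [Fintype ι] [Nonempty ι] [IsFiniteMeasure ν]
    (hH : IsMonotoneFamily ν H r) (hs : s ∈ Icc (0 : ι → ℝ) (fun _ => r)) (hs0 : s ≠ 0) :
    ∑ i, ν.real (cell H s i) = ν.real univ := by
  have hU : (⋃ i ∈ (Finset.univ : Finset ι), cell H s i) = univ := by
    ext x
    simpa using exists_mem_cell H s x
  rw [← hU, measureReal_biUnion_finset₀ _ fun i _ => (hH.measurableSet_cell s i).nullMeasurableSet]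
  intro i _ j _ hij
  refine measure_mono_null (fun x hx => ?_) (hH.tie s hs hs0)
  exact fun h => hij (h i j hx.1 hx.2)

/-- At a point with a unique maximal index, that index stays the only maximal one under small
changes of the parameters. Dominated convergence turns this into continuity of the masses. -/
lemma continuousAt_measureReal_cell [Finite ι] [Nonempty ι] [IsFiniteMeasure ν]
    (hH : IsMonotoneFamily ν H r) (hs : s ∈ Icc (0 : ι → ℝ) (fun _ => r)) (hs0 : s ≠ 0) (i : ι) :
    ContinuousAt (fun s => ν.real (cell H s i)) s := by
  refine (ENNReal.tendsto_toReal (measure_ne_top _ _)).comp ?_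
  refine tendsto_measure_of_ae_tendsto_indicator_of_isFiniteMeasure (nhds s)
    (hH.measurableSet_cell s i) (fun s => hH.measurableSet_cell s i) ?_
  filter_upwards [hH.tie s hs hs0] with x hx
  obtain ⟨k, hk⟩ := exists_mem_cell H s x
  have hlt : ∀ j, j ≠ k → H j (s j) x < H k (s k) x := by
    intro j hj
    by_contra hcon
    exact hj (hx j k (fun l => (hk l).trans (not_lt.1 hcon)) hk)
  have hcont : ∀ j, Continuous fun s : ι → ℝ => H j (s j) x := fun j =>
    (hH.continuous j x).comp (continuous_apply j)
  have hev : ∀ᶠ s' in nhds s, ∀ j, j ≠ k → H j (s' j) x < H k (s' k) x := by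
    refine Filter.eventually_all.2 fun j => ?_
    by_cases hj : j = k
    · simp [hj]
    · filter_upwards [(hcont j).continuousAt.eventually_lt (hcont k).continuousAt (hlt j hj)]
        with s' hs' _ using hs'
  have hcell : ∀ s' : ι → ℝ, (∀ j, j ≠ k → H j (s' j) x < H k (s' k) x) →
      (x ∈ cell H s' i ↔ i = k) := by
    intro s' h
    constructor
    · intro hi
      by_contra hik
      exact absurd (hi k) (not_le.2 (h i hik))
    · rintro rfl j
      by_cases hj : j = i
      · rw [hj]
      · exact (h j hj).le
  filter_upwards [hev] with s' hs'
  rw [hcell s' hs', hcell s hlt]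

open Classical in
lemma continuousAt_measureReal_cell_update [Finite ι] [Nonempty ι] [IsFiniteMeasure ν]
    (hH : IsMonotoneFamily ν H r) (hs : s ∈ Icc (0 : ι → ℝ) (fun _ => r)) (hs0 : s ≠ 0) (i : ι) :
    ContinuousAt (fun t => ν.real (cell H (Function.update s i t) i)) (s i) := by
  have h1 : ContinuousAt (fun s => ν.real (cell H s i)) (Function.update s i (s i)) := by
    rw [Function.update_eq_self]
    exact hH.continuousAt_measureReal_cell hs hs0 i
  have h2 : Continuous fun t : ℝ => Function.update s i t :=
    continuous_const.update i continuous_id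
  exact ContinuousAt.comp (f := fun t : ℝ => Function.update s i t) h1 h2.continuousAt

/-- The cell of `i` shrinks if the parameter of `i` is lowered and the others are raised. -/
lemma measureReal_cell_mono [IsFiniteMeasure ν] (hH : IsMonotoneFamily ν H r)
    (hs : s ∈ Icc (0 : ι → ℝ) (fun _ => r)) (hs' : s' ∈ Icc (0 : ι → ℝ) (fun _ => r))
    (hi : s' i ≤ s i) (hj : ∀ j, j ≠ i → s j ≤ s' j) :
    ν.real (cell H s' i) ≤ ν.real (cell H s i) := by
  refine ENNReal.toReal_mono (measure_ne_top _ _) (measure_mono_ae ?_)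
  filter_upwards [hH.strictMono] with x hx hxi j
  by_cases hji : j = i
  · rw [hji]
  · calc H j (s j) x ≤ H j (s' j) x :=
          (hx j).monotoneOn ⟨hs.1 j, hs.2 j⟩ ⟨hs'.1 j, hs'.2 j⟩ (hj j hji)
      _ ≤ H i (s' i) x := hxi j
      _ ≤ H i (s i) x := (hx i).monotoneOn ⟨hs'.1 i, hs'.2 i⟩ ⟨hs.1 i, hs.2 i⟩ hi

lemma measureReal_cell_eq_zero (hH : IsMonotoneFamily ν H r)
    (hs : s ∈ Icc (0 : ι → ℝ) (fun _ => r)) (hs0 : s ≠ 0) (hi : s i = 0) :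
    ν.real (cell H s i) = 0 := by
  obtain ⟨j, hj⟩ := Function.ne_iff.1 hs0
  have hjpos : 0 < s j := lt_of_le_of_ne (hs.1 j) (Ne.symm hj)
  have : ν (cell H s i) = 0 := by
    rw [← compl_compl (cell H s i), ← mem_ae_iff]
    filter_upwards [hH.strictMono, hH.zero] with x hx hx0 hxi
    have h1 := hxi j
    have h2 := hx j ⟨le_rfl, hjpos.le.trans (hs.2 j)⟩ ⟨hs.1 j, hs.2 j⟩ hjpos
    simp only [hi, hx0] at h1 h2
    linarith
  rw [Measure.real, this, ENNReal.toReal_zero]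

/-- Compactness of the set of sub-solutions in a closed set `R` of parameters. The origin, where
all functions of the family vanish and the cells are discontinuous, has to be excluded. -/
lemma isCompact_subsolutions [Finite ι] [Nonempty ι] [IsFiniteMeasure ν]
    (hH : IsMonotoneFamily ν H r)
    {R : Set (ι → ℝ)} (hR : IsClosed R) (hRbox : R ⊆ Icc (0 : ι → ℝ) (fun _ => r))
    (hR0 : ∀ s ∈ R, s ≠ 0) (a : ι → ℝ) (i₀ : ι) :
    IsCompact {s ∈ R | ∀ i, i ≠ i₀ → ν.real (cell H s i) ≤ a i} := by
  have hcl : IsClosed {s ∈ R | ∀ i, i ≠ i₀ → ν.real (cell H s i) ≤ a i} := by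
    have : {s ∈ R | ∀ i, i ≠ i₀ → ν.real (cell H s i) ≤ a i}
        = R ∩ ⋂ i, R ∩ {s | i ≠ i₀ → ν.real (cell H s i) ≤ a i} := by
      ext s
      simp only [mem_inter_iff, mem_iInter, mem_ofPred_eq]
      exact ⟨fun h => ⟨h.1, fun i => ⟨h.1, h.2 i⟩⟩, fun h => ⟨h.1, fun i => (h.2 i).2⟩⟩
    rw [this]
    refine hR.inter (isClosed_iInter fun i => ?_)
    by_cases hi : i = i₀
    · simpa [hi] using hR
    · have hcont : ContinuousOn (fun s => ν.real (cell H s i)) R := fun s hs =>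
        (hH.continuousAt_measureReal_cell (hRbox hs) (hR0 s hs) i).continuousWithinAt
      simpa [hi] using! hcont.preimage_isClosed_of_isClosed hR (isClosed_Iic (a := a i))
  exact isCompact_Icc.of_isClosed_subset hcl fun s hs => hRbox hs.1

open Classical in
/-- Solvability of the semi-discrete problem: every prescribed vector `a` of masses is the vector
of masses of the cells of some `s ∈ [0, r]^ι` with `max s = r`.

With one index `i₀` of positive mass singled out, a sub-solution is an `s` whose cells other than
that of `i₀` are not too large. Among the sub-solutions with `max s = r` take one with least
`s i₀`, and among those the largest. If its cell of `i₀` were too large, this would persist after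
`s i₀` is lowered to some `t`. The largest sub-solution `σ` with `σ i₀ = t` has all entries below
`r`, by the choice of `s i₀`, so its cells are exactly as prescribed; but `σ ≤ s`, which makes the
cell of `i₀` for `σ` at least as large as for `s` with `s i₀` lowered to `t`. -/
theorem exists_measureReal_cell_eq [Fintype ι] [IsFiniteMeasure ν] (hH : IsMonotoneFamily ν H r)
    (hr : 0 < r) {a : ι → ℝ} (ha : ∀ i, 0 ≤ a i) {i₀ : ι} (hi₀ : 0 < a i₀)
    (hsum : ∑ i, a i = ν.real univ) :
    ∃ s ∈ Icc (0 : ι → ℝ) (fun _ => r), (∃ i, s i = r) ∧ ∀ i, ν.real (cell H s i) = a i := by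
  have : Nonempty ι := ⟨i₀⟩
  set box := Icc (0 : ι → ℝ) (fun _ => r) with hbox
  have hboxcl : IsClosed box := isClosed_Icc
  have hmaxcl : IsClosed {s : ι → ℝ | ∃ i, s i = r} := by
    have : {s : ι → ℝ | ∃ i, s i = r} = ⋃ i, {s | s i = r} := by
      ext
      simp
    rw [this]
    exact isClosed_iUnion_of_finite fun i => isClosed_eq (continuous_apply i) continuous_const
  have hne_max : ∀ s : ι → ℝ, (∃ i, s i = r) → s ≠ 0 := by
    rintro s ⟨i, hi⟩ rfl
    exact hr.ne hi
  have hne_t : ∀ (s : ι → ℝ) {t : ℝ}, 0 < t → s i₀ = t → s ≠ 0 := by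
    rintro s t ht hst rfl
    exact ht.ne hst
  have hsumcont : Continuous fun s : ι → ℝ => ∑ i, s i := by fun_prop
  have heval : ∀ t : ℝ, IsClosed {s : ι → ℝ | s i₀ = t} := fun t =>
    isClosed_eq (continuous_apply i₀) continuous_const
  -- the cell of an index with parameter zero is negligible
  have hsingle : ∀ t ∈ Ioc 0 r, (Pi.single i₀ t : ι → ℝ) ∈ box ∧
      ∀ i, i ≠ i₀ → ν.real (cell H (Pi.single i₀ t) i) ≤ a i := by
    intro t ht
    have hb : (Pi.single i₀ t : ι → ℝ) ∈ box := by
      constructor <;> intro i <;> by_cases h : i = i₀ <;> simp [h, ht.1.le, ht.2, hr.le]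
    refine ⟨hb, fun i hi => ?_⟩
    rw [hH.measureReal_cell_eq_zero hb (hne_t _ ht.1 (by simp)) (by simp [hi])]
    exact ha i
  -- the least value of `s i₀`
  have hc1 := hH.isCompact_subsolutions (hboxcl.inter hmaxcl) inter_subset_left
    (fun s hs => hne_max s hs.2) a i₀
  obtain ⟨s₁, hs₁, hmin⟩ := hc1.exists_isMinOn
    ⟨Pi.single i₀ r, ⟨(hsingle r ⟨hr, le_rfl⟩).1, i₀, by simp⟩, (hsingle r ⟨hr, le_rfl⟩).2⟩
    (continuous_apply i₀).continuousOn
  -- the largest sub-solution with that value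
  have hc2 := hH.isCompact_subsolutions ((hboxcl.inter hmaxcl).inter (heval (s₁ i₀)))
    (inter_subset_left.trans inter_subset_left) (fun s hs => hne_max s hs.1.2) a i₀
  obtain ⟨s, ⟨⟨⟨hsb, hsr⟩, hs0⟩, hsa⟩, hmax⟩ := hc2.exists_isMaxOn ⟨s₁, ⟨hs₁.1, rfl⟩, hs₁.2⟩
    hsumcont.continuousOn
  have hsum_s := hH.sum_measureReal_cell hsb (hne_max s hsr)
  simp only [mem_ofPred_eq] at hs0
  suffices hle : ν.real (cell H s i₀) ≤ a i₀ by
    refine ⟨s, hsb, hsr, fun i => ?_⟩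
    have hall : ∀ i ∈ Finset.univ, ν.real (cell H s i) ≤ a i := by
      intro i _
      by_cases hi : i = i₀
      · rwa [hi]
      · exact hsa i hi
    exact (Finset.sum_eq_sum_iff_of_le hall).1 (hsum_s.trans hsum.symm) i (Finset.mem_univ i)
  by_contra! hgt
  have hspos : 0 < s i₀ := by
    refine lt_of_le_of_ne (hsb.1 i₀) fun h => ?_
    rw [hH.measureReal_cell_eq_zero hsb (hne_max s hsr) h.symm] at hgt
    linarith
  -- lower the parameter of `i₀` slightly
  obtain ⟨t, ht0, hts, htgt⟩ : ∃ t, 0 < t ∧ t < s i₀ ∧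
      a i₀ < ν.real (cell H (Function.update s i₀ t) i₀) := by
    have hev : ∀ᶠ t in nhds (s i₀), a i₀ < ν.real (cell H (Function.update s i₀ t) i₀) := by
      refine (hH.continuousAt_measureReal_cell_update hsb (hne_max s hsr) i₀).eventually_const_lt ?_
      simpa using hgt
    have hev2 : ∀ᶠ t in nhdsWithin (s i₀) (Iio (s i₀)), 0 < t ∧ t < s i₀ ∧
        a i₀ < ν.real (cell H (Function.update s i₀ t) i₀) := by
      filter_upwards [nhdsWithin_le_nhds hev, nhdsWithin_le_nhds (eventually_gt_nhds hspos),
        self_mem_nhdsWithin] with t h1 h2 h3 using ⟨h2, h3, h1⟩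
    exact hev2.exists
  have htr : t ≤ r := hts.le.trans (hsb.2 i₀)
  -- the largest sub-solution `σ` with `σ i₀ = t` solves the problem with masses `a`
  have hc3 := hH.isCompact_subsolutions (hboxcl.inter (heval t)) inter_subset_left
    (fun s hs => hne_t s ht0 hs.2) a i₀
  obtain ⟨σ, ⟨⟨hσb, hσt⟩, hσa⟩, hσmax⟩ := hc3.exists_isMaxOn
    ⟨Pi.single i₀ t, ⟨(hsingle t ⟨ht0, htr⟩).1, by simp⟩, (hsingle t ⟨ht0, htr⟩).2⟩
    hsumcont.continuousOn
  simp only [mem_ofPred_eq] at hσt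
  have hσ0 := hne_t σ ht0 hσt
  have hσr : ∀ i, σ i < r := by
    intro i
    refine lt_of_le_of_ne (hσb.2 i) fun h => ?_
    have : s₁ i₀ ≤ σ i₀ := hmin (a := σ) ⟨⟨hσb, i, h⟩, hσa⟩
    linarith
  have hσeq : ∀ i, i ≠ i₀ → ν.real (cell H σ i) = a i := by
    intro i hi
    by_contra hne
    have hlt := lt_of_le_of_ne (hσa i hi) hne
    have hev : ∀ᶠ t in nhds (σ i), ν.real (cell H (Function.update σ i t) i) < a i := by
      refine (hH.continuousAt_measureReal_cell_update hσb hσ0 i).eventually_lt_const ?_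
      simpa using hlt
    have hev2 : ∀ᶠ t in nhdsWithin (σ i) (Ioi (σ i)), t < r ∧ σ i < t ∧
        ν.real (cell H (Function.update σ i t) i) < a i := by
      filter_upwards [nhdsWithin_le_nhds hev, nhdsWithin_le_nhds (eventually_lt_nhds (hσr i)),
        self_mem_nhdsWithin] with t h1 h2 h3 using ⟨h2, h3, h1⟩
    obtain ⟨u, hur, hσu, hu⟩ := hev2.exists
    have hub : Function.update σ i u ∈ box :=
      update_mem_Icc hσb i ⟨(hσb.1 i).trans hσu.le, hur.le⟩
    have hle := hσmax (a := Function.update σ i u) ⟨⟨hub, by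
      rw [mem_ofPred_eq, Function.update_of_ne (Ne.symm hi), hσt]⟩, fun j hj => by
        by_cases hji : j = i
        · rw [hji]
          exact hu.le
        · refine (hH.measureReal_cell_mono hσb hub ?_ fun k hk => ?_).trans (hσa j hj)
          · rw [Function.update_of_ne hji]
          · by_cases hki : k = i
            · rw [hki, Function.update_self]
              exact hσu.le
            · rw [Function.update_of_ne hki]⟩
    have hlt : ∑ j, σ j < ∑ j, Function.update σ i u j := by
      refine Finset.sum_lt_sum (fun j _ => ?_) ⟨i, Finset.mem_univ i, by simpa using hσu⟩
      by_cases h : j = i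
      · rw [h, Function.update_self]
        exact hσu.le
      · rw [Function.update_of_ne h]
    exact absurd hle (not_le.2 hlt)
  have hσeq₀ : ν.real (cell H σ i₀) = a i₀ := by
    have h1 := (hH.sum_measureReal_cell hσb hσ0).trans hsum.symm
    rw [← Finset.add_sum_erase _ _ (Finset.mem_univ i₀),
      ← Finset.add_sum_erase _ a (Finset.mem_univ i₀)] at h1
    rw [Finset.sum_congr rfl fun i hi => hσeq i (Finset.ne_of_mem_erase hi)] at h1
    linarith
  -- sub-solutions are stable under suprema, so `σ ≤ s` by the choice of `s`
  have hmb : s ⊔ σ ∈ box := ⟨hsb.1.trans le_sup_left, sup_le hsb.2 hσb.2⟩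
  have hmi : (s ⊔ σ) i₀ = s i₀ := by
    simp [hσt, hts.le]
  have hma : ∀ i, i ≠ i₀ → ν.real (cell H (s ⊔ σ) i) ≤ a i := by
    intro i hi
    rcases le_total (σ i) (s i) with h | h
    · refine (hH.measureReal_cell_mono hsb hmb (by simp [h]) fun j _ => ?_).trans (hsa i hi)
      exact le_sup_left
    · refine (hH.measureReal_cell_mono hσb hmb (by simp [h]) fun j _ => ?_).trans (hσa i hi)
      exact le_sup_right
  have hmr : ∃ i, (s ⊔ σ) i = r := by
    obtain ⟨i, hi⟩ := hsr
    exact ⟨i, by simp [hi, (hσr i).le]⟩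
  have hle : ∑ i, (s ⊔ σ) i ≤ ∑ i, s i :=
    hmax (a := s ⊔ σ) ⟨⟨⟨hmb, hmr⟩, by rw [mem_ofPred_eq, hmi, hs0]⟩, hma⟩
  have hσs : ∀ i, σ i ≤ s i := by
    intro i
    by_contra! h
    refine absurd hle (not_le.2 (Finset.sum_lt_sum (fun j _ => ?_) ⟨i, Finset.mem_univ i, ?_⟩))
    · exact (le_sup_left : s ≤ s ⊔ σ) j
    · exact h.trans_le ((le_sup_right : σ ≤ s ⊔ σ) i)
  have hub : Function.update s i₀ t ∈ box := update_mem_Icc hsb i₀ ⟨ht0.le, htr⟩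
  have := hH.measureReal_cell_mono hσb hub (i := i₀) (by simp [hσt]) fun j hj => by
    rw [Function.update_of_ne hj]
    exact hσs j
  linarith

/-- A measurable choice of the index of the cell that contains a given point. -/
lemma exists_measurable_selector [Finite ι] [Nonempty ι] [MeasurableSpace ι]
    (hH : IsMonotoneFamily ν H r) (s : ι → ℝ) :
    ∃ T : X → ι, Measurable T ∧ ∀ x, x ∈ cell H s (T x) := by
  classical
  have := Fintype.ofFinite ι
  obtain ⟨i₁⟩ := ‹Nonempty ι›
  suffices h : ∀ t : Finset ι, ∃ T : X → ι, Measurable T ∧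
      ∀ x, (∃ i ∈ t, x ∈ cell H s i) → x ∈ cell H s (T x) by
    obtain ⟨T, hT, hT'⟩ := h Finset.univ
    have : Nonempty ι := ⟨i₁⟩
    exact ⟨T, hT, fun x => hT' x (by simpa using exists_mem_cell H s x)⟩
  intro t
  induction t using Finset.induction_on with
  | empty => exact ⟨fun _ => i₁, measurable_const, by simp⟩
  | insert i t _ ih =>
    obtain ⟨T, hT, hT'⟩ := ih
    refine ⟨(cell H s i).piecewise (fun _ => i) T,
      measurable_const.piecewise (hH.measurableSet_cell s i) hT, ?_⟩
    intro x hx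
    by_cases hxi : x ∈ cell H s i
    · rwa [piecewise_eq_of_mem _ _ _ hxi]
    · rw [piecewise_eq_of_notMem _ _ _ hxi]
      refine hT' x ?_
      simpa [hxi] using hx

lemma measureReal_preimage_selector (hH : IsMonotoneFamily ν H r)
    (hs : s ∈ Icc (0 : ι → ℝ) (fun _ => r)) (hs0 : s ≠ 0) {T : X → ι}
    (hT : ∀ x, x ∈ cell H s (T x)) (i : ι) : ν.real (T ⁻¹' {i}) = ν.real (cell H s i) := by
  refine measureReal_congr ?_
  filter_upwards [hH.tie s hs hs0] with x hx
  refine propext ⟨fun h => ?_, fun h => hx _ _ (hT x) h⟩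
  rw [← (h : T x = i)]
  exact hT x

end IsMonotoneFamily
end Cells

/-! ### Envelopes of compact families of ovals -/

open TopologicalSpace (NonemptyCompacts)

/-- The upper envelope of the ovals in a compact family; the pair `(P, s)` stands for the oval with
focus `P` through the point `s x₀`. -/
def envelope {n : ℕ} {D : Set (Space n)} {r : ℝ} (κ : ℝ) (x₀ : Sph n)
    (K : NonemptyCompacts (D × Icc 0 r)) (x : Sph n) : ℝ :=
  sSup ((fun y : D × Icc 0 r => axisRadius κ x₀ y.1 y.2 x) '' K)

section Envelope

variable {n : ℕ} {κ τ r₀ r : ℝ} {Ω : Set (Sph n)} {D : Set (Space n)} {x₀ : Sph n}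
  {K : NonemptyCompacts (D × Icc 0 r)} {x : Sph n} {y : D × Icc 0 r}

lemma continuous_axisRadius_pair (κ : ℝ) (x₀ x : Sph n) :
    Continuous fun y : D × Icc 0 r => axisRadius κ x₀ y.1 y.2 x :=
  AxisSetup.continuous_axisRadius κ x₀ (continuous_subtype_val.comp continuous_fst)
    (continuous_subtype_val.comp continuous_snd) continuous_const

lemma exists_envelope_eq (κ : ℝ) (x₀ : Sph n) (K : NonemptyCompacts (D × Icc 0 r)) (x : Sph n) :
    ∃ y ∈ K, envelope κ x₀ K x = axisRadius κ x₀ y.1 y.2 x := by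
  obtain ⟨y, hy, h⟩ := K.isCompact.exists_sSup_image_eq K.nonempty
    (continuous_axisRadius_pair κ x₀ x).continuousOn
  exact ⟨y, hy, h⟩

lemma le_envelope (hy : y ∈ K) : axisRadius κ x₀ y.1 y.2 x ≤ envelope κ x₀ K x :=
  le_csSup (K.isCompact.bddAbove_image (continuous_axisRadius_pair κ x₀ x).continuousOn)
    ⟨y, hy, rfl⟩

lemma envelope_eq_iff (hy : y ∈ K) : envelope κ x₀ K x = axisRadius κ x₀ y.1 y.2 x ↔
    ∀ z ∈ K, axisRadius κ x₀ z.1 z.2 x ≤ axisRadius κ x₀ y.1 y.2 x := by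
  constructor
  · intro h z hz
    rw [← h]
    exact le_envelope hz
  · intro h
    obtain ⟨z, hz, hzx⟩ := exists_envelope_eq κ x₀ K x
    exact le_antisymm (hzx ▸ h z hz) (le_envelope hy)

namespace AxisSetup

lemma envelope_le (S : AxisSetup κ τ r₀ r Ω D x₀) (hx : x ∈ closure Ω) :
    envelope κ x₀ K x ≤ r₀ := by
  obtain ⟨y, hy, h⟩ := exists_envelope_eq κ x₀ K x
  rw [h]
  exact S.axisRadius_le y.1.2 y.2.2 hx

lemma envelope_pos (S : AxisSetup κ τ r₀ r Ω D x₀) (hy : y ∈ K) (hy0 : 0 < (y.2 : ℝ))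
    (hx : x ∈ closure Ω) : 0 < envelope κ x₀ K x :=
  (S.axisRadius_pos y.1.2 y.2.2 hy0 hx).trans_le (le_envelope hy)

lemma envelope_self (S : AxisSetup κ τ r₀ r Ω D x₀) (hy : y ∈ K) (hyr : (y.2 : ℝ) = r) :
    envelope κ x₀ K x₀ = r := by
  have h1 := le_envelope (κ := κ) (x₀ := x₀) (x := x₀) hy
  obtain ⟨z, hz, h⟩ := exists_envelope_eq κ x₀ K x₀
  rw [S.axisRadius_self z.1.2 z.2.2] at h
  rw [S.axisRadius_self y.1.2 y.2.2, hyr] at h1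
  exact le_antisymm (h ▸ z.2.2.2) h1

lemma exists_lipschitz_envelope (S : AxisSetup κ τ r₀ r Ω D x₀) :
    ∃ C : NNReal, ∀ K : NonemptyCompacts (D × Icc 0 r),
      LipschitzOnWith C (envelope κ x₀ K) (closure Ω) := by
  obtain ⟨C, hC⟩ := S.exists_lipschitz
  refine ⟨C, fun K => LipschitzOnWith.of_le_add_mul C fun x hx x' hx' => ?_⟩
  obtain ⟨y, hy, h⟩ := exists_envelope_eq κ x₀ K x
  rw [h]
  have h1 := (hC y.1 y.1.2 y.2 y.2.2).dist_le_mul x hx x' hx'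
  rw [Real.dist_eq] at h1
  linarith [le_abs_self (axisRadius κ x₀ y.1 y.2 x - axisRadius κ x₀ y.1 y.2 x'),
    le_envelope (κ := κ) (x₀ := x₀) (x := x') hy]

/-- Each oval that attains the envelope supports it. -/
lemma mem_refractorMap (S : AxisSetup κ τ r₀ r Ω D x₀) {z : D × Icc 0 r} (hz : z ∈ K)
    (hz0 : 0 < (z.2 : ℝ)) (hx : x ∈ closure Ω) (hy : y ∈ K)
    (hyx : envelope κ x₀ K x = axisRadius κ x₀ y.1 y.2 x) :
    y.1 ∈ refractorMap κ Ω D (envelope κ x₀ K) x := by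
  have hy0 : 0 < (y.2 : ℝ) := by
    refine lt_of_le_of_ne y.2.2.1 fun h0 => ?_
    have := S.envelope_pos hz hz0 hx
    rw [hyx, ← h0, S.axisRadius_zero y.1.2 hx] at this
    exact this.false
  exact ⟨axisParam κ x₀ y.1 y.2,
    { lt_b := S.norm_lt_axisParam y.1.2 y.2.2
      b_lt := S.axisParam_lt y.1.2 y.2.2 hy0
      directions := fun x' hx' => S.mem_ovalDirections y.1.2 y.2.2 hx'
      le := fun x' _ => le_envelope hy
      eq := hyx }⟩

lemma isRefractor_envelope (S : AxisSetup κ τ r₀ r Ω D x₀) {z : D × Icc 0 r} (hz : z ∈ K)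
    (hz0 : 0 < (z.2 : ℝ)) : IsRefractor κ r₀ Ω D (envelope κ x₀ K) where
  continuousOn := by
    obtain ⟨C, hC⟩ := S.exists_lipschitz_envelope
    exact (hC K).continuousOn
  pos x hx := S.envelope_pos hz hz0 hx
  subset_cone := by
    rintro _ ⟨x, hx, rfl⟩
    exact ⟨x, hx, _, S.envelope_pos hz hz0 hx, S.envelope_le hx, rfl⟩
  supported x hx := by
    obtain ⟨y, hy, hyx⟩ := exists_envelope_eq κ x₀ K x
    obtain ⟨b, hb⟩ := S.mem_refractorMap hz hz0 hx hy hyx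
    exact ⟨y.1, y.1.2, b, hb⟩

lemma ae_refractorMap_envelope_subsingleton (S : AxisSetup κ τ r₀ r Ω D x₀) (hΩ : IsOpen Ω)
    (hvis : ∀ X ∈ cone Ω r₀, ∀ m : Space n, ‖m‖ = 1 → (D ∩ ray X m).Subsingleton)
    {z : D × Icc 0 r} (hz : z ∈ K) (hz0 : 0 < (z.2 : ℝ)) :
    ∀ᵐ x ∂(surf n).restrict Ω, (refractorMap κ Ω D (envelope κ x₀ K) x).Subsingleton := by
  obtain ⟨C, hC⟩ := S.exists_lipschitz_envelope
  exact (ae_restrict_iff' hΩ.measurableSet).2 (ae_refractorMap_subsingleton S.adm hvis hΩ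
    (fun x hx => S.envelope_le hx) (fun x hx => S.envelope_pos hz hz0 hx) (hC K))

end AxisSetup

/-! ### Targets with finite support -/

namespace AxisSetup

/-- Ties have measure zero: both ovals would support the envelope of the finite family, whose
refractor map is single-valued almost everywhere. -/
lemma isMonotoneFamily {ι : Type*} [Finite ι] (S : AxisSetup κ τ r₀ r Ω D x₀) (hΩ : IsOpen Ω)
    (hvis : ∀ X ∈ cone Ω r₀, ∀ m : Space n, ‖m‖ = 1 → (D ∩ ray X m).Subsingleton)
    {ν : Measure (Sph n)} (hν : ν ≪ (surf n).restrict Ω) {c : ι → D}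
    (hc : Function.Injective c) :
    IsMonotoneFamily ν (fun i s x => axisRadius κ x₀ (c i) s x) r := by
  have hΩν : ∀ᵐ x ∂ν, x ∈ Ω := hν.ae_le (ae_restrict_mem hΩ.measurableSet)
  refine ⟨fun i s => Continuous.measurable ?_, fun i x => ?_, ?_, ?_, ?_⟩
  · exact continuous_axisRadius κ x₀ continuous_const continuous_const continuous_id
  · exact continuous_axisRadius κ x₀ continuous_const continuous_id continuous_const
  · filter_upwards [hΩν] with x hx i
    exact S.strictMonoOn_axisRadius (c i).2 (subset_closure hx)
  · filter_upwards [hΩν] with x hx i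
    exact S.axisRadius_zero (c i).2 (subset_closure hx)
  · intro s hs hs0
    obtain ⟨k, hk⟩ := Function.ne_iff.1 hs0
    have hkpos : 0 < s k := lt_of_le_of_ne (hs.1 k) (Ne.symm hk)
    let p : ι → D × Icc 0 r := fun i => (c i, ⟨s i, hs.1 i, hs.2 i⟩)
    let K : NonemptyCompacts (D × Icc 0 r) :=
      ⟨⟨range p, (finite_range p).isCompact⟩, ⟨p k, k, rfl⟩⟩
    have hK : ∀ i, p i ∈ K := fun i => ⟨i, rfl⟩
    filter_upwards [hΩν, hν.ae_le (S.ae_refractorMap_envelope_subsingleton hΩ hvis (hK k) hkpos)]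
      with x hx hsub i j hi hj
    have hmem : ∀ i, x ∈ cell (fun i s x => axisRadius κ x₀ (c i) s x) s i →
        c i ∈ refractorMap κ Ω D (envelope κ x₀ K) x := by
      intro i hi
      refine S.mem_refractorMap (y := p i) (hK k) hkpos (subset_closure hx) (hK i)
        ((envelope_eq_iff (hK i)).2 ?_)
      rintro _ ⟨j, rfl⟩
      exact hi j
    exact hc (hsub (hmem i hi) (hmem j hj))

/-- If the target measure is carried by finitely many points, it is the image of `ν` under the
refractor map of an envelope through `r x₀`. -/
lemma exists_envelope_of_finite {ι : Type*} [Finite ι] [MeasurableSpace ι]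
    [MeasurableSingletonClass ι] (S : AxisSetup κ τ r₀ r Ω D x₀) (hΩ : IsOpen Ω)
    (hvis : ∀ X ∈ cone Ω r₀, ∀ m : Space n, ‖m‖ = 1 → (D ∩ ray X m).Subsingleton)
    {ν : Measure (Sph n)} [IsFiniteMeasure ν] (hν : ν ≪ (surf n).restrict Ω)
    {c : ι → D} (hc : Function.Injective c) {m : Measure ι} [IsFiniteMeasure m]
    (hm : m ≠ 0) (hmν : ν univ = m univ) :
    ∃ (K : NonemptyCompacts (D × Icc 0 r)) (T : Sph n → D × Icc 0 r), Measurable T ∧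
      (∃ y ∈ K, (y.2 : ℝ) = r) ∧
      (∀ x, T x ∈ K ∧ envelope κ x₀ K x = axisRadius κ x₀ (T x).1 (T x).2 x) ∧
      ν.map (fun x => (T x).1) = m.map c := by
  have := Fintype.ofFinite ι
  have hH := S.isMonotoneFamily hΩ hvis hν hc
  have hsum : ∑ i, m.real {i} = ν.real univ := by
    rw [sum_measureReal_singleton, Finset.coe_univ, Measure.real, Measure.real, hmν]
  obtain ⟨i₀, hi₀⟩ : ∃ i, 0 < m.real {i} := by
    by_contra! h
    refine hm (Measure.ext_of_singleton fun i => ?_)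
    have := le_antisymm (h i) measureReal_nonneg
    rwa [measureReal_eq_zero_iff] at this
  have : Nonempty ι := ⟨i₀⟩
  obtain ⟨s, hs, ⟨k, hk⟩, hcell⟩ := hH.exists_measureReal_cell_eq S.r_pos
    (a := fun i => m.real {i}) (fun i => measureReal_nonneg) hi₀ hsum
  have hs0 : s ≠ 0 := by
    rintro rfl
    exact S.r_pos.ne hk
  obtain ⟨T, hT, hTcell⟩ := hH.exists_measurable_selector s
  let p : ι → D × Icc 0 r := fun i => (c i, ⟨s i, hs.1 i, hs.2 i⟩)
  let K : NonemptyCompacts (D × Icc 0 r) :=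
    ⟨⟨range p, (finite_range p).isCompact⟩, ⟨p k, k, rfl⟩⟩
  have hK : ∀ i, p i ∈ K := fun i => ⟨i, rfl⟩
  have hpm : Measurable p := measurable_of_countable p
  refine ⟨K, fun x => p (T x), hpm.comp hT, ⟨p k, hK k, hk⟩, fun x => ⟨hK _, ?_⟩, ?_⟩
  · refine (envelope_eq_iff (hK _)).2 ?_
    rintro _ ⟨j, rfl⟩
    exact hTcell x j
  · have hmap : ν.map T = m := by
      refine Measure.ext_of_singleton fun i => ?_
      rw [Measure.map_apply hT (measurableSet_singleton i),
        ← measureReal_eq_measureReal_iff, hH.measureReal_preimage_selector hs hs0 hTcell i,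
        hcell i]
    rw [← hmap, Measure.map_map (measurable_of_countable c) hT]
    rfl

end AxisSetup

/-! ### Passage to the limit -/

/-- Limits of maximal elements of the families `K j` are maximal in the limit family. -/
lemma envelope_eq_of_tendsto {K' : ℕ → NonemptyCompacts (D × Icc 0 r)}
    (hK : Filter.Tendsto K' Filter.atTop (nhds K)) {y' : ℕ → D × Icc 0 r}
    (hy' : ∀ j, y' j ∈ K' j ∧ envelope κ x₀ (K' j) x = axisRadius κ x₀ (y' j).1 (y' j).2 x)
    (hy : Filter.Tendsto y' Filter.atTop (nhds y)) :
    y ∈ K ∧ envelope κ x₀ K x = axisRadius κ x₀ y.1 y.2 x := by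
  have hdist : Filter.Tendsto (fun j => dist (K' j) K) Filter.atTop (nhds 0) :=
    tendsto_iff_dist_tendsto_zero.1 hK
  have hfin : ∀ K₁ K₂ : NonemptyCompacts (D × Icc 0 r),
      Metric.hausdorffEDist (K₁ : Set (D × Icc 0 r)) K₂ ≠ ⊤ := fun K₁ K₂ =>
    Metric.hausdorffEDist_ne_top_of_nonempty_of_bounded K₁.nonempty K₂.nonempty
      K₁.isCompact.isBounded K₂.isCompact.isBounded
  have hyK : y ∈ K := by
    have h1 : Metric.infDist y (K : Set (D × Icc 0 r)) = 0 := by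
      refine tendsto_nhds_unique
        ((Metric.continuous_infDist_pt (K : Set (D × Icc 0 r))).continuousAt.tendsto.comp hy)
        (squeeze_zero (fun j => Metric.infDist_nonneg) (fun j => ?_) hdist)
      rw [Metric.NonemptyCompacts.dist_eq]
      exact Metric.infDist_le_hausdorffDist_of_mem (hy' j).1 (hfin _ _)
    exact (K.isCompact.isClosed.mem_iff_infDist_zero K.nonempty).2 h1
  refine ⟨hyK, (envelope_eq_iff hyK).2 fun z hz => ?_⟩
  have hex : ∀ j, ∃ z' ∈ (K' j : Set (D × Icc 0 r)), Metric.infDist z (K' j) = dist z z' :=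
    fun j => (K' j).isCompact.exists_infDist_eq_dist (K' j).nonempty z
  choose z' hz' hzz' using hex
  have hztend : Filter.Tendsto z' Filter.atTop (nhds z) := by
    rw [tendsto_iff_dist_tendsto_zero]
    refine squeeze_zero (fun j => dist_nonneg) (fun j => ?_) hdist
    rw [dist_comm, ← hzz', dist_comm (K' j), Metric.NonemptyCompacts.dist_eq]
    exact Metric.infDist_le_hausdorffDist_of_mem hz (hfin _ _)
  have hcont := continuous_axisRadius_pair (D := D) (r := r) κ x₀ x
  exact le_of_tendsto_of_tendsto' (hcont.continuousAt.tendsto.comp hztend)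
    (hcont.continuousAt.tendsto.comp hy)
    fun j => (envelope_eq_iff (hy' j).1).1 (hy' j).2 (z' j) (hz' j)

end Envelope

namespace AxisSetup

variable {n : ℕ} {κ τ r₀ r : ℝ} {Ω : Set (Sph n)} {D : Set (Space n)} {x₀ : Sph n}

/-- For every target measure of the right total mass there is an envelope through `r x₀` whose
refractor map transports `ν` to it. -/
theorem exists_envelope (S : AxisSetup κ τ r₀ r Ω D x₀) (hΩ : IsOpen Ω)
    (hvis : ∀ X ∈ cone Ω r₀, ∀ m : Space n, ‖m‖ = 1 → (D ∩ ray X m).Subsingleton)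
    {ν : Measure (Sph n)} [IsFiniteMeasure ν] (hν : ν ≪ (surf n).restrict Ω)
    {μ : Measure D} [IsFiniteMeasure μ] (hμ : μ ≠ 0) (hμν : ν univ = μ univ) :
    ∃ (K : NonemptyCompacts (D × Icc 0 r)) (T : Sph n → D), Measurable T ∧
      (∃ y ∈ K, (y.2 : ℝ) = r) ∧
      (∀ᵐ x ∂(surf n).restrict Ω, T x ∈ refractorMap κ Ω D (envelope κ x₀ K) x) ∧
      ν.map T = μ := by
  have hDne : Nonempty D := by
    by_contra hne
    rw [not_nonempty_iff] at hne
    exact hμ (Measure.eq_zero_of_isEmpty μ)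
  have : CompactSpace D := isCompact_iff_compactSpace.1 S.isCompact
  -- discretize the target measure
  let φ : ℕ → SimpleFunc D D := SimpleFunc.nearestPt (TopologicalSpace.denseSeq D)
  have hφ : ∀ P, Filter.Tendsto (fun k => φ k P) Filter.atTop (nhds P) := fun P =>
    SimpleFunc.tendsto_nearestPt (TopologicalSpace.denseRange_denseSeq D P)
  have hex : ∀ k, ∃ (K : NonemptyCompacts (D × Icc 0 r)) (T : Sph n → D × Icc 0 r),
      Measurable T ∧ (∃ y ∈ K, (y.2 : ℝ) = r) ∧
      (∀ x, T x ∈ K ∧ envelope κ x₀ K x = axisRadius κ x₀ (T x).1 (T x).2 x) ∧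
      ν.map (fun x => (T x).1) = μ.map (φ k) := by
    intro k
    let ψ : D → (φ k).range := fun P => ⟨φ k P, (φ k).mem_range_self P⟩
    have hψ : Measurable ψ := (φ k).measurable.subtype_mk
    obtain ⟨K, T, hT, hKr, hTK, hmap⟩ := S.exists_envelope_of_finite hΩ hvis hν
      (c := fun i : (φ k).range => (i : D)) Subtype.val_injective (m := μ.map ψ)
      (fun h => hμ ((Measure.map_eq_zero_iff hψ.aemeasurable).1 h))
      (by rw [Measure.map_apply hψ MeasurableSet.univ, preimage_univ, hμν])
    refine ⟨K, T, hT, hKr, hTK, ?_⟩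
    rw [hmap, Measure.map_map measurable_subtype_coe hψ]
    rfl
  choose K' T' hT' hKr' hTK' hmap' using hex
  -- extract a convergent subsequence of families of ovals
  obtain ⟨K, -, θ, hθ, hK⟩ := CompactSpace.isCompact_univ.tendsto_subseq fun k => mem_univ (K' k)
  choose z' hz' hzr' using hKr'
  have hzr : ∃ y ∈ K, (y.2 : ℝ) = r := by
    obtain ⟨y, θ', hθ', hy⟩ := CompactSpace.tendsto_subseq fun k => z' (θ k)
    refine ⟨y, ?_, ?_⟩
    · refine (envelope_eq_of_tendsto (κ := κ) (x₀ := x₀) (x := x₀)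
        (hK.comp hθ'.tendsto_atTop) (fun j => ⟨hz' _, ?_⟩) hy).1
      refine (S.envelope_self (hz' _) (hzr' _)).trans ?_
      rw [S.axisRadius_self (z' _).1.2 (z' _).2.2, hzr']
    · refine tendsto_nhds_unique
        ((continuous_subtype_val.comp continuous_snd).continuousAt.tendsto.comp hy) ?_
      simp only [Function.comp_def, hzr']
      exact tendsto_const_nhds
  obtain ⟨z, hz, hzr₀⟩ := id hzr
  have hz0 : 0 < (z.2 : ℝ) := by rw [hzr₀]; exact S.r_pos
  -- almost everywhere convergence of the refractor maps
  choose y hyK hyx using exists_envelope_eq κ x₀ K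
  have hlim : ∀ᵐ x ∂(surf n).restrict Ω,
      Filter.Tendsto (fun k => (T' (θ k) x).1) Filter.atTop (nhds (y x).1) := by
    filter_upwards [S.ae_refractorMap_envelope_subsingleton hΩ hvis hz hz0,
      ae_restrict_mem hΩ.measurableSet] with x hsub hxΩ
    refine Filter.tendsto_of_subseq_tendsto fun ns hns => ?_
    obtain ⟨w, ms, hms, hw⟩ := CompactSpace.tendsto_subseq fun k => T' (θ (ns k)) x
    refine ⟨ms, ?_⟩
    obtain ⟨hwK, hwx⟩ := envelope_eq_of_tendsto
      (hK.comp (hns.comp hms.tendsto_atTop)) (fun j => hTK' _ x) hw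
    have hxc := subset_closure hxΩ
    rw [hsub (S.mem_refractorMap hz hz0 hxc (hyK x) (hyx x))
      (S.mem_refractorMap hz hz0 hxc hwK hwx)]
    exact (continuous_fst.tendsto w).comp hw
  have hT'm : ∀ k, Measurable fun x => (T' k x).1 := fun k => measurable_fst.comp (hT' k)
  have haem : AEMeasurable (fun x => (y x).1) ((surf n).restrict Ω) :=
    aemeasurable_of_tendsto_metrizable_ae Filter.atTop (fun k => (hT'm (θ k)).aemeasurable) hlim
  refine ⟨K, haem.mk, haem.measurable_mk, hzr, ?_, ?_⟩
  · filter_upwards [haem.ae_eq_mk, ae_restrict_mem hΩ.measurableSet] with x hx hxΩ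
    rw [← hx]
    exact S.mem_refractorMap hz hz0 (subset_closure hxΩ) (hyK x) (hyx x)
  · refine ext_of_forall_integral_eq_of_IsFiniteMeasure fun g => ?_
    have hgm : ∀ m : Measure D, AEStronglyMeasurable g m := fun m =>
      g.continuous.aestronglyMeasurable
    rw [integral_map haem.measurable_mk.aemeasurable (hgm _)]
    have hlim1 : Filter.Tendsto (fun k => ∫ x, g (T' (θ k) x).1 ∂ν) Filter.atTop
        (nhds (∫ x, g (haem.mk _ x) ∂ν)) := by
      refine tendsto_integral_of_dominated_convergence (fun _ => ‖g‖)
        (fun k => (g.continuous.measurable.comp (hT'm (θ k))).aestronglyMeasurable)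
        (integrable_const _) (fun k => Filter.Eventually.of_forall fun x => g.norm_coe_le_norm _) ?_
      filter_upwards [hν.ae_le hlim, hν.ae_le haem.ae_eq_mk] with x hx hx'
      rw [← hx']
      exact (g.continuous.tendsto _).comp hx
    have hlim2 : Filter.Tendsto (fun k => ∫ P, g (φ (θ k) P) ∂μ) Filter.atTop
        (nhds (∫ P, g P ∂μ)) := by
      refine tendsto_integral_of_dominated_convergence (fun _ => ‖g‖)
        (fun k => (g.continuous.measurable.comp (φ (θ k)).measurable).aestronglyMeasurable)
        (integrable_const _) (fun k => Filter.Eventually.of_forall fun x => g.norm_coe_le_norm _) ?_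
      exact Filter.Eventually.of_forall fun P =>
        (g.continuous.tendsto _).comp ((hφ P).comp hθ.tendsto_atTop)
    refine tendsto_nhds_unique hlim1 (hlim2.congr fun k => ?_)
    rw [← integral_map (hT'm (θ k)).aemeasurable (hgm _), hmap' (θ k),
      integral_map (φ (θ k)).measurable.aemeasurable (hgm _)]

end AxisSetup

/-! ### Weak solutions -/

/-- A refractor whose refractor map is almost everywhere single-valued and transports `f dx` to `μ`
is a weak solution. -/
lemma isWeakSolution_of_map_eq {n : ℕ} {κ r₀ : ℝ} {Ω : Set (Sph n)} {D : Set (Space n)}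
    {f : Sph n → ℝ} {μ : Measure D} {ρ : Sph n → ℝ} (hΩ : IsOpen Ω)
    (hΩb : surf n (frontier Ω) = 0) (hf : IntegrableOn f Ω (surf n))
    (hf0 : 0 ≤ᵐ[(surf n).restrict Ω] f) (hρ : IsRefractor κ r₀ Ω D ρ)
    (hsub : ∀ᵐ x ∂(surf n).restrict Ω, (refractorMap κ Ω D ρ x).Subsingleton)
    {T : Sph n → D} (hT : Measurable T)
    (hmem : ∀ᵐ x ∂(surf n).restrict Ω, T x ∈ refractorMap κ Ω D ρ x)
    (hmap : (((surf n).restrict Ω).withDensity fun x => ENNReal.ofReal (f x)).map T = μ) :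
    IsWeakSolution κ r₀ Ω D f μ ρ := by
  have hpre : ∀ F : Set D, refractorPreimage κ Ω D ρ F =ᵐ[surf n] (T ⁻¹' F ∩ Ω : Set (Sph n)) := by
    intro F
    have hb : ∀ᵐ x ∂(surf n), x ∉ frontier Ω := measure_eq_zero_iff_ae_notMem.1 hΩb
    filter_upwards [hb, (ae_restrict_iff' hΩ.measurableSet).1 hsub,
      (ae_restrict_iff' hΩ.measurableSet).1 hmem] with x hxb hxs hxm
    refine propext ⟨?_, fun ⟨hxF, hxΩ⟩ => ⟨subset_closure hxΩ, T x, hxm hxΩ, hxF⟩⟩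
    rintro ⟨hxc, P, hP, hPF⟩
    have hxΩ : x ∈ Ω := by
      by_contra hx
      exact hxb ⟨hxc, by rwa [hΩ.interior_eq]⟩
    refine ⟨?_, hxΩ⟩
    rw [mem_preimage, hxs hxΩ (hxm hxΩ) hP]
    exact hPF
  refine ⟨hρ, fun F hF => ?_, fun F hF => ?_⟩
  · exact ((hT hF).inter hΩ.measurableSet).nullMeasurableSet.congr (hpre F).symm
  · rw [setIntegral_congr_set (hpre F), ← Measure.restrict_restrict (hT hF),
      integral_eq_lintegral_of_nonneg_ae (ae_restrict_of_ae hf0)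
        hf.aestronglyMeasurable.restrict, ← hmap, Measure.real,
      Measure.map_apply hT hF, withDensity_apply _ (hT hF)]

/-- The hypotheses of the refractor problem yield the standing geometric assumptions. -/
lemma axisSetup_of_conditions {n : ℕ} {κ τ r₀ r : ℝ} (hκ : 1 < κ) {Ω : Set (Sph n)}
    {D : Set (Space n)} (hD : IsCompact D) (hD0 : (0 : Space n) ∉ D)
    (hangle : AngleCondition κ τ Ω D) (hvis : VisibilityCondition κ τ r₀ Ω D) {x₀ : Sph n}
    (hx₀ : x₀ ∈ closure Ω) (hr : 0 < r) (hDne : D.Nonempty)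
    (hrlt : r < r₀ ^ 4 / (8 * (sSup ((fun P : Space n => ‖P‖) '' D)) ^ 3)) :
    AxisSetup κ τ r₀ r Ω D x₀ := by
  have hτ := hangle.tau_pos
  have hτ1 : κ * τ < κ - 1 := by
    have := mul_lt_mul_of_pos_left hangle.tau_lt (by linarith : 0 < κ)
    rwa [mul_sub, mul_one_div_cancel (by linarith), mul_one] at this
  have hr₀ := hvis.r_pos
  have hκ1 : 0 < κ - 1 := sub_pos.2 hκ
  have hκτ : 0 < κ * τ := by positivity
  have hbb : BddBelow ((fun P : Space n => ‖P‖) '' D) :=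
    ⟨0, by rintro _ ⟨P, -, rfl⟩; exact norm_nonneg P⟩
  have hba : BddAbove ((fun P : Space n => ‖P‖) '' D) :=
    hD.bddAbove_image continuous_norm.continuousOn
  -- the smallness of `r₀`, in terms of `σ = κ τ / (2 (κ - 1)) < 1 / 2`
  set σ := κ * τ / (2 * (κ - 1)) with hσ
  have hσ0 : 0 < σ := by positivity
  have hσ1 : σ < 1 / 2 := by
    rw [hσ, div_lt_iff₀ (by positivity)]
    linarith
  have hσκ : κ * τ = 2 * (κ - 1) * σ := by
    rw [hσ]
    field_simp
  have hsq : κ ^ 2 * τ ^ 2 / (4 * (κ - 1) ^ 2) = σ ^ 2 := by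
    rw [hσ, div_pow]
    ring
  have hlt : ∀ P ∈ D, r₀ < σ ^ 2 * ‖P‖ := fun P hP => by
    have h := hvis.r_lt
    rw [hsq] at h
    exact h.trans_le (mul_le_mul_of_nonneg_left (csInf_le hbb ⟨P, hP, rfl⟩) (sq_nonneg σ))
  refine ⟨hκ, hτ, hτ1.le, hr, ?_, hx₀, hD, fun x hx P hP => ⟨hκ, hτ, ?_, ?_, ?_⟩⟩
  · obtain ⟨P, hP⟩ := hDne
    have hM : ‖P‖ ≤ sSup ((fun P : Space n => ‖P‖) '' D) := le_csSup hba ⟨P, hP, rfl⟩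
    set M := sSup ((fun P : Space n => ‖P‖) '' D)
    have hrM : r₀ ≤ σ ^ 2 * M :=
      (hlt P hP).le.trans (mul_le_mul_of_nonneg_left hM (sq_nonneg σ))
    have hM0 : 0 < M := by
      by_contra h
      nlinarith [sq_nonneg σ]
    have h1 : r₀ ^ 4 ≤ 8 * M ^ 3 * (σ * r₀) := by
      have h2 : r₀ ^ 3 ≤ (σ ^ 2 * M) ^ 3 := pow_le_pow_left₀ hr₀.le hrM 3
      have h3 : σ ^ 5 ≤ 8 := by
        calc σ ^ 5 ≤ 1 ^ 5 := pow_le_pow_left₀ hσ0.le (by linarith) 5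
          _ ≤ 8 := by norm_num
      have h4 : σ ^ 5 * (σ * M ^ 3) ≤ 8 * (σ * M ^ 3) := by gcongr
      calc r₀ ^ 4 = r₀ ^ 3 * r₀ := by ring
        _ ≤ (σ ^ 2 * M) ^ 3 * r₀ := by gcongr
        _ = σ ^ 5 * (σ * M ^ 3) * r₀ := by ring
        _ ≤ 8 * (σ * M ^ 3) * r₀ := by gcongr
        _ = _ := by ring
    have h5 : r ≤ σ * r₀ := by
      refine hrlt.le.trans ?_
      rw [div_le_iff₀ (by positivity)]
      linarith
    rw [hσκ]
    nlinarith
  · exact norm_pos_iff.2 fun h => hD0 (h ▸ hP)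
  · have hp : 0 < ‖P‖ := norm_pos_iff.2 fun h => hD0 (h ▸ hP)
    have h := hangle.angle x hx P hP
    rw [le_div_iff₀ hp] at h
    have h2 := mul_le_mul_of_nonneg_left h (by linarith : 0 ≤ κ)
    have h3 : κ * ((1 / κ + τ) * ‖P‖) = (1 + κ * τ) * ‖P‖ := by
      field_simp
    linarith
  · have h1 : κ ^ 2 * τ * ‖P‖ = 2 * κ * (κ - 1) * σ * ‖P‖ := by
      linear_combination κ * ‖P‖ * hσκ
    have h2 : 2 * (κ ^ 2 - 1) * r₀ ≤ 2 * (κ ^ 2 - 1) * (σ ^ 2 * ‖P‖) :=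
      mul_le_mul_of_nonneg_left (hlt P hP).le (by nlinarith)
    have h3 : (κ + 1) * σ ≤ κ := by nlinarith
    have h4 : (κ + 1) * σ * (2 * (κ - 1) * σ * ‖P‖) ≤ κ * (2 * (κ - 1) * σ * ‖P‖) := by gcongr
    linarith

end
end NearField

open NearField in
theorem mainTheorem2 (n : ℕ) (hn : 2 ≤ n) (κ τ r₀ : ℝ) (hκ : 1 < κ)
    (Ω : Set (NearField.Sph n)) (hΩo : IsOpen Ω) (hΩc : IsConnected Ω)
    (hΩb : NearField.surf n (frontier Ω) = 0)
    (D : Set (NearField.Space n)) (hD : IsCompact D) (hD0 : (0 : NearField.Space n) ∉ D)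
    (hangle : NearField.AngleCondition κ τ Ω D)
    (hvis : NearField.VisibilityCondition κ τ r₀ Ω D)
    (f : NearField.Sph n → ℝ) (hf : MeasureTheory.IntegrableOn f Ω (NearField.surf n))
    (hfpos : ∀ᵐ x ∂((NearField.surf n).restrict Ω), 0 < f x)
    (μ : MeasureTheory.Measure D) [MeasureTheory.IsFiniteMeasure μ]
    (henergy : ∫ x in Ω, f x ∂(NearField.surf n) = μ.real Set.univ)
    (X₀ : NearField.Space n) (hX₀ : X₀ ∈ NearField.cone Ω r₀) (hX₀pos : 0 < ‖X₀‖)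
    (hX₀lt : ‖X₀‖ < r₀ ^ 4 / (8 * (sSup ((fun P : NearField.Space n => ‖P‖) '' D)) ^ 3)) :
    ∃ ρ : NearField.Sph n → ℝ,
      NearField.IsWeakSolution κ r₀ Ω D f μ ρ ∧ X₀ ∈ NearField.radialGraph Ω ρ := by
  have hf0 : 0 ≤ᵐ[(surf n).restrict Ω] f := hfpos.mono fun x hx => hx.le
  -- positivity of the total energy
  have hμ : μ ≠ 0 := by
    rintro rfl
    rw [measureReal_zero_apply, integral_eq_zero_iff_of_nonneg_ae hf0 hf] at henergy
    have : ∀ᵐ x ∂(surf n).restrict Ω, False := by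
      filter_upwards [hfpos, henergy] with x h1 h2
      exact h1.ne' h2
    rw [Filter.eventually_false_iff_eq_bot, ae_eq_bot, Measure.restrict_eq_zero] at this
    exact hΩo.measure_ne_zero _ hΩc.nonempty this
  have hDne : D.Nonempty := by
    rw [nonempty_iff_ne_empty]
    rintro rfl
    exact hμ (Measure.eq_zero_of_isEmpty μ)
  obtain ⟨x₀, hx₀, t, ht, -, rfl⟩ := hX₀
  have hnorm : ‖t • (x₀ : Space n)‖ = t := by simp [norm_smul, abs_of_pos ht]
  rw [hnorm] at hX₀lt
  have S := axisSetup_of_conditions hκ hD hD0 hangle hvis hx₀ ht hDne hX₀lt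
  set ν := ((surf n).restrict Ω).withDensity fun x => ENNReal.ofReal (f x)
  have : IsFiniteMeasure ν := isFiniteMeasure_withDensity_ofReal hf.2
  have hνμ : ν univ = μ univ := by
    rw [withDensity_apply _ MeasurableSet.univ, Measure.restrict_univ,
      ← ofReal_integral_eq_lintegral_ofReal hf hf0, henergy, ofReal_measureReal]
  obtain ⟨K, T, hT, ⟨y, hy, hyt⟩, hmem, hmap⟩ := S.exists_envelope hΩo hvis.visible
    (withDensity_absolutelyContinuous _ _) hμ hνμ
  have hy0 : 0 < (y.2 : ℝ) := by rw [hyt]; exact ht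
  refine ⟨envelope κ x₀ K, isWeakSolution_of_map_eq hΩo hΩb hf hf0 (S.isRefractor_envelope hy hy0)
    (S.ae_refractorMap_envelope_subsingleton hΩo hvis.visible hy hy0) hT hmem hmap, x₀, hx₀, ?_⟩
  rw [S.envelope_self hy hyt]
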